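/- Let $q_1,\dots,q_m:\mathbb R^{n}\to\mathbb R$ be smooth and $g_1,\dots,g_l:\mathbb R^{n}\to\mathbb R$ continuous, and let $$M=\{x\in\mathbb R^{n}: q_i(x)=0\ (1\le i\le m),\ g_j(x)>0\ (1\le j\le l)\}.$$ Assume that the gradients $\nabla q_1(x),\dots,\nabla q_m(x)$ are linearly independent at every $x\in M$. Put $d=n-m$, $Q_xa=\sum_j a_j\nabla q_j(x)$ for $a\in\mathbb R^m$, $T_x=\{\nabla q_1(x),\dots,\nabla q_m(x)\}^{\perp}$, and let $\sigma$ be $d$-dimensional Hausdorff measure on $M$ (normalized to agree with Lebesgue measure on $\mathbb R^d$). For each $x\in M$ let $p(\cdot|x)\ge 0$ be a probability density with respect to Lebesgue measure on $T_x$, jointly measurable in $(x,v)$. Let $f:M\to[0,\infty)$ be measurable with $0<Z=\int_M f\,d\sigma<\infty$, and let $\rho(dx)=Z^{-1}f(x)\,\sigma(dx)$. Fix a deterministic measurable solver that, started from $(x,v)$, either fails or succeeds and returns $a$ with $q_i(x+v+Q_xa)=0$ exactly for all $i$; it need not find a solution when one exists. (An example is Newton's method from $a=0$, idealized so that it returns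 the limit of its iterates.) For $x,y\in M$ let $v(x,y)$ be the orthogonal projection of $y-x$ onto $T_x$. One step of the algorithm from $X_k=x$ is as follows. 1. Draw $v\in T_x$ with density $p(\cdot|x)$. If the solver succeeds from $(x,v)$ and $y=x+v+Q_xa$ satisfies $g_j(y)>0$ for all $j$, then $y$ is the proposal. Otherwise the proposal fails, the proposed point is taken to be $x$, and $X_{k+1}=x$. 2. If $y$ was proposed, draw $u$ uniformly on $[0,1]$, independently of $v$. Put $v'=v(y,x)$, so that $x=y+v'+w'$ with $v'\in T_y$ and $w'\perp T_y$. Set $X_{k+1}=y$ if $u\le\min\bigl(1,\frac{f(y)p(v'|y)}{f(x)p(v|x)}\bigr)$ and the solver started from $(y,v')$ succeeds and recovers $x$ (reverse-projection check). Otherwise set $X_{k+1}=x$. Let $P_x$ be the law of the proposed point, $R_x$ the law of $X_{k+1}$ given $X_k=x$, $\zeta(x)$ the probability that the proposal fails, and $\xi(x)$ the total probability that no move is accepted. Let $F_x\subset M$ be the set of points $y$ that the solver does not return from $(x,v)$ for any $v\in T_x$. Let $U_x$ be a matrix whose columns are an orthonormal basis of $T_x$, and put $$J(y|x)=|\det(U_x^{t}U_y)|,\qquad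 h(y|x)=(1-\mathbf 1_{F_x}(y))\,p(v(x,y)|x)\,J(y|x),\qquad a(y|x)=\min\Bigl(1,\frac{f(y)h(x|y)}{f(x)h(y|x)}\Bigr),$$ with the convention that a quotient with zero denominator is $0$. Then: (i) $h$ is jointly measurable, and for all $x\in M$, $P_x(dy)=h(y|x)\,\sigma(dy)+\zeta(x)\,\delta_x(dy)$ and $\int_M h(y|x)\,\sigma(dy)+\zeta(x)=1$. (ii) For all $x\in M$, $R_x(dy)=a(y|x)h(y|x)\,\sigma(dy)+\xi(x)\,\delta_x(dy)$ and $\xi(x)=\zeta(x)+\int_M(1-a(y|x))h(y|x)\,\sigma(dy)$. (iii) Detailed balance: $f(x)a(y|x)h(y|x)=f(y)a(x|y)h(x|y)$ for all $x,y\in M$. (iv) $\rho$ is a probability measure, and $x\mapsto R_x$ is a Markov kernel on $M$ that is reversible with respect to $\rho$ and leaves $\rho$ invariant: if $X_k\sim\rho$ then $X_{k+1}\sim\rho$. -/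

import Mathlib

open MeasureTheory ProbabilityTheory Filter Topology
open scoped NNReal ENNReal

namespace ConstrainedMCMC

noncomputable section

/-! ### The constraint manifold -/

/-- `M = {x | q_i(x) = 0 for all i, g_j(x) > 0 for all j}`. -/
def constraintManifold {n m l : ℕ} (q : Fin m → EuclideanSpace ℝ (Fin n) → ℝ)
    (g : Fin l → EuclideanSpace ℝ (Fin n) → ℝ) : Set (EuclideanSpace ℝ (Fin n)) :=
  {x | (∀ i, q i x = 0) ∧ ∀ j, 0 < g j x}

/-- `Q_x a = ∑ a_j ∇q_j(x)`, where the columns of `Q_x` are the gradients of the constraints. -/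
def normalMove {n m : ℕ} (q : Fin m → EuclideanSpace ℝ (Fin n) → ℝ)
    (x : EuclideanSpace ℝ (Fin n)) (a : EuclideanSpace ℝ (Fin m)) : EuclideanSpace ℝ (Fin n) :=
  ∑ j, a j • gradient (q j) x

/-- The tangent space `T_x`: the orthogonal complement of the gradients `∇q_j(x)`. -/
def tangentSpace {n m : ℕ} (q : Fin m → EuclideanSpace ℝ (Fin n) → ℝ)
    (x : EuclideanSpace ℝ (Fin n)) : Submodule ℝ (EuclideanSpace ℝ (Fin n)) :=
  (Submodule.span ℝ (Set.range fun j => gradient (q j) x))ᗮ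

/-- The `T_x`-component `v` of `z = v + w`, with `v ∈ T_x` and `w ⊥ T_x`. -/
def tangentPart {n m : ℕ} (q : Fin m → EuclideanSpace ℝ (Fin n) → ℝ)
    (x z : EuclideanSpace ℝ (Fin n)) : EuclideanSpace ℝ (Fin n) :=
  (tangentSpace q x).starProjection z

/-- An orthonormal basis of `T_x`, consisting of `d = n - m` vectors whenever the gradients at `x`
are linearly independent (the other branch is never used at such points). -/
def tangentFrame {n m : ℕ} (q : Fin m → EuclideanSpace ℝ (Fin n) → ℝ)
    (x : EuclideanSpace ℝ (Fin n)) : Fin (n - m) → EuclideanSpace ℝ (Fin n) := fun i =>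
  if hd : Module.finrank ℝ (tangentSpace q x) = n - m then
    (((stdOrthonormalBasis ℝ (tangentSpace q x)).reindex (finCongr hd) i : tangentSpace q x) :
      EuclideanSpace ℝ (Fin n))
  else 0

/-- Lebesgue measure of `T_x`, as a measure on the ambient space: the image of Lebesgue measure
of `ℝ^d` under the coordinates of an orthonormal basis of `T_x`. -/
def tangentVolume {n m : ℕ} (q : Fin m → EuclideanSpace ℝ (Fin n) → ℝ)
    (x : EuclideanSpace ℝ (Fin n)) : Measure (EuclideanSpace ℝ (Fin n)) :=
  Measure.map (fun c : EuclideanSpace ℝ (Fin (n - m)) => ∑ i, c i • tangentFrame q x i) volume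

/-- The surface measure `σ`: `d`-dimensional Hausdorff measure on `M`, for the metric inherited from
the ambient space, normalized so as to agree with Lebesgue measure on `ℝ^d`. -/
def surfaceMeasure {n m l : ℕ} (q : Fin m → EuclideanSpace ℝ (Fin n) → ℝ)
    (g : Fin l → EuclideanSpace ℝ (Fin n) → ℝ) : Measure (constraintManifold q g) :=
  Measure.euclideanHausdorffMeasure (n - m)

/-! ### The projection step -/

/-- A deterministic nonlinear solver for `q(x + v + Q_x a) = 0`, whose constraints hold exactly:
started from `x` and `v` it either fails, or succeeds and returns a vector `a` that solves the
equations exactly. It need not find a solution when there is one. -/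
structure ExactSolver {n m : ℕ} (q : Fin m → EuclideanSpace ℝ (Fin n) → ℝ) where
  /-- The pairs `(x, v)` from which the solver succeeds. -/
  success : Set (EuclideanSpace ℝ (Fin n) × EuclideanSpace ℝ (Fin n))
  /-- The vector `a` that is returned (irrelevant where the solver fails). -/
  coeff : EuclideanSpace ℝ (Fin n) × EuclideanSpace ℝ (Fin n) → EuclideanSpace ℝ (Fin m)
  measurableSet_success : MeasurableSet success
  measurable_coeff : Measurable coeff
  exact_solution : ∀ x v, (x, v) ∈ success → ∀ i, q i (x + v + normalMove q x (coeff (x, v))) = 0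

/-- The point `x + v + Q_x a` for the vector `a` returned by the solver. -/
def ExactSolver.target {n m : ℕ} {q : Fin m → EuclideanSpace ℝ (Fin n) → ℝ} (S : ExactSolver q)
    (x v : EuclideanSpace ℝ (Fin n)) : EuclideanSpace ℝ (Fin n) :=
  x + v + normalMove q x (S.coeff (x, v))

/-! Newton's method is such a solver. Its flag is that of the usual algorithm (the residual falls
below a tolerance within `nmax` iterations); that the constraints hold exactly is idealized by
returning the limit of the iterates, which has to exist and to solve the equations. -/

/-- The matrix `∂ q_i(x + v + Q_x a) / ∂ a_j = ∇q_i(x + v + Q_x a)ᵗ ∇q_j(x)`. -/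
def newtonJacobian {n m : ℕ} (q : Fin m → EuclideanSpace ℝ (Fin n) → ℝ)
    (x v : EuclideanSpace ℝ (Fin n)) (a : EuclideanSpace ℝ (Fin m)) : Matrix (Fin m) (Fin m) ℝ :=
  Matrix.of fun i j => inner ℝ (gradient (q i) (x + v + normalMove q x a)) (gradient (q j) x)

/-- The residual `q(x + v + Q_x a)`. -/
def residual {n m : ℕ} (q : Fin m → EuclideanSpace ℝ (Fin n) → ℝ)
    (x v : EuclideanSpace ℝ (Fin n)) (a : EuclideanSpace ℝ (Fin m)) : EuclideanSpace ℝ (Fin m) :=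
  WithLp.toLp 2 fun i => q i (x + v + normalMove q x a)

/-- Newton's iterates from the initial guess `a = 0`. Where the Jacobian is singular the inverse is
`0`, so that the iteration stays at a point which is not a solution, and the solver fails. -/
def newtonIterate {n m : ℕ} (q : Fin m → EuclideanSpace ℝ (Fin n) → ℝ) :
    ℕ → EuclideanSpace ℝ (Fin n) × EuclideanSpace ℝ (Fin n) → EuclideanSpace ℝ (Fin m)
  | 0, _ => 0
  | k + 1, z => newtonIterate q k z -
      WithLp.toLp 2 (Matrix.mulVec (newtonJacobian q z.1 z.2 (newtonIterate q k z))⁻¹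
        (WithLp.ofLp (residual q z.1 z.2 (newtonIterate q k z))))

theorem continuous_gradient {n m : ℕ} {q : Fin m → EuclideanSpace ℝ (Fin n) → ℝ}
    (hq : ∀ i, ContDiff ℝ (⊤ : ℕ∞) (q i)) (i : Fin m) : Continuous (gradient (q i)) := by
  unfold gradient
  exact (LinearIsometryEquiv.continuous _).comp ((hq i).continuous_fderiv (by simp))

theorem measurable_move {n m : ℕ} {q : Fin m → EuclideanSpace ℝ (Fin n) → ℝ}
    (hq : ∀ i, ContDiff ℝ (⊤ : ℕ∞) (q i))
    {a : EuclideanSpace ℝ (Fin n) × EuclideanSpace ℝ (Fin n) → EuclideanSpace ℝ (Fin m)}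
    (ha : Measurable a) : Measurable fun z => z.1 + z.2 + normalMove q z.1 (a z) := by
  have h1 := fun i => (continuous_gradient hq i).measurable
  unfold normalMove
  fun_prop

theorem measurable_residual {n m : ℕ} {q : Fin m → EuclideanSpace ℝ (Fin n) → ℝ}
    (hq : ∀ i, ContDiff ℝ (⊤ : ℕ∞) (q i))
    {a : EuclideanSpace ℝ (Fin n) × EuclideanSpace ℝ (Fin n) → EuclideanSpace ℝ (Fin m)}
    (ha : Measurable a) : Measurable fun z => residual q z.1 z.2 (a z) := by
  have h1 := fun i => (hq i).continuous.measurable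
  have h2 := measurable_move hq ha
  unfold residual
  fun_prop

theorem measurable_det {m : ℕ} {α : Type*} [MeasurableSpace α] {A : α → Matrix (Fin m) (Fin m) ℝ}
    (hA : ∀ i j, Measurable fun z => A z i j) : Measurable fun z => (A z).det := by
  simp only [Matrix.det_apply']
  exact Finset.measurable_sum _ fun s _ =>
    measurable_const.mul (Finset.measurable_prod _ fun i _ => hA (s i) i)

theorem measurable_newtonIterate {n m : ℕ} {q : Fin m → EuclideanSpace ℝ (Fin n) → ℝ}
    (hq : ∀ i, ContDiff ℝ (⊤ : ℕ∞) (q i)) (k : ℕ) : Measurable (newtonIterate q k) := by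
  induction k with
  | zero => exact measurable_const
  | succ k ih =>
    have h1 := measurable_residual hq ih
    have h2 : ∀ i j, Measurable fun z : EuclideanSpace ℝ (Fin n) × EuclideanSpace ℝ (Fin n) =>
        newtonJacobian q z.1 z.2 (newtonIterate q k z) i j := by
      intro i j
      have h3 := fun i => (continuous_gradient hq i).measurable
      have h4 := measurable_move hq ih
      simp only [newtonJacobian, Matrix.of_apply]
      exact ((h3 i).comp h4).inner ((h3 j).comp measurable_fst)
    have hadj : ∀ i j, Measurable fun z : EuclideanSpace ℝ (Fin n) × EuclideanSpace ℝ (Fin n) =>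
        (newtonJacobian q z.1 z.2 (newtonIterate q k z)).adjugate i j := by
      intro i j
      simp only [Matrix.adjugate_apply]
      refine measurable_det fun a b => ?_
      by_cases hab : a = j
      · simp [hab]
      · simpa [Matrix.updateRow_apply, hab] using h2 a b
    have hinv : ∀ i j, Measurable fun z : EuclideanSpace ℝ (Fin n) × EuclideanSpace ℝ (Fin n) =>
        (newtonJacobian q z.1 z.2 (newtonIterate q k z))⁻¹ i j := by
      intro i j
      simp only [Matrix.inv_def, Ring.inverse_eq_inv', Matrix.smul_apply, smul_eq_mul]
      exact (measurable_det h2).inv.mul (hadj i j)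
    have h6 : Measurable fun z : EuclideanSpace ℝ (Fin n) × EuclideanSpace ℝ (Fin n) =>
        Matrix.mulVec (newtonJacobian q z.1 z.2 (newtonIterate q k z))⁻¹
          (WithLp.ofLp (residual q z.1 z.2 (newtonIterate q k z))) := by
      refine measurable_pi_lambda _ fun i => ?_
      simp only [Matrix.mulVec, dotProduct]
      refine Finset.measurable_sum _ fun j _ => (hinv i j).mul ?_
      have h7 : Measurable fun w : EuclideanSpace ℝ (Fin m) => w j := by fun_prop
      exact h7.comp h1
    simp only [newtonIterate]
    fun_prop

/-- Newton's method, as an exact solver. -/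
def newtonSolver {n m : ℕ} (q : Fin m → EuclideanSpace ℝ (Fin n) → ℝ)
    (hq : ∀ i, ContDiff ℝ (⊤ : ℕ∞) (q i)) (tol : ℝ) (nmax : ℕ) : ExactSolver q where
  success := {z | (∃ k ≤ nmax, ‖residual q z.1 z.2 (newtonIterate q k z)‖ ≤ tol) ∧
    (∃ a, Tendsto (fun k => newtonIterate q k z) atTop (𝓝 a)) ∧
    residual q z.1 z.2 (limUnder atTop fun k => newtonIterate q k z) = 0}
  coeff z := limUnder atTop fun k => newtonIterate q k z
  measurableSet_success := by
    have hk := measurable_newtonIterate hq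
    have hlim : Measurable fun z => limUnder atTop fun k => newtonIterate q k z :=
      (StronglyMeasurable.limUnder (l := atTop) fun k => (hk k).stronglyMeasurable).measurable
    refine MeasurableSet.inter ?_ (MeasurableSet.inter ?_ ?_)
    · have : {z | ∃ k ≤ nmax, ‖residual q z.1 z.2 (newtonIterate q k z)‖ ≤ tol} =
          ⋃ k : ℕ, ⋃ _ : k ≤ nmax, {z | ‖residual q z.1 z.2 (newtonIterate q k z)‖ ≤ tol} := by
        ext z; simp
      change MeasurableSet {z | ∃ k ≤ nmax, ‖residual q z.1 z.2 (newtonIterate q k z)‖ ≤ tol}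
      rw [this]
      exact MeasurableSet.iUnion fun k => MeasurableSet.iUnion fun _ =>
        measurableSet_le (measurable_residual hq (hk k)).norm measurable_const
    · exact MeasureTheory.measurableSet_exists_tendsto hk
    · exact measurable_residual hq hlim (measurableSet_singleton 0)
  measurable_coeff :=
    (StronglyMeasurable.limUnder (l := atTop) fun k =>
      (measurable_newtonIterate hq k).stronglyMeasurable).measurable
  exact_solution := by
    intro x v h i
    have h1 := congrArg (fun w : EuclideanSpace ℝ (Fin m) => w i) h.2.2
    simpa [residual] using h1

/-! ### The algorithm -/

section Algorithm

variable {n m l : ℕ} {q : Fin m → EuclideanSpace ℝ (Fin n) → ℝ}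
  {g : Fin l → EuclideanSpace ℝ (Fin n) → ℝ}

/-- The proposal phase from `x` with tangential move `v` is successful: the projection succeeds and
the resulting point satisfies the inequality constraints. -/
def ProposalSucceeds (S : ExactSolver q) (x : constraintManifold q g)
    (v : EuclideanSpace ℝ (Fin n)) : Prop :=
  ((x : EuclideanSpace ℝ (Fin n)), v) ∈ S.success ∧ ∀ j, 0 < g j (S.target x v)

open Classical in
/-- The proposed point: `y = x + v + Q_x a`, or `x` itself if the proposal phase failed. -/
def propose (S : ExactSolver q) (x : constraintManifold q g) (v : EuclideanSpace ℝ (Fin n)) :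
    constraintManifold q g :=
  if hv : ProposalSucceeds S x v then ⟨S.target x v, S.exact_solution x v hv.1, hv.2⟩ else x

/-- The tangential move from `x` to `y`: the `v ∈ T_x` with `y = x + v + w`, `w ⊥ T_x`. -/
def tangentialMove (x y : constraintManifold q g) : EuclideanSpace ℝ (Fin n) :=
  tangentPart q x ((y : EuclideanSpace ℝ (Fin n)) - x)

/-- The reverse-projection check: with the reverse move `v'` (where `x = y + v' + w'`, `v' ∈ T_y`,
`w' ⊥ T_y`), the solver started from `y` succeeds and recovers `x`. -/
def ReverseProjectionSucceeds (S : ExactSolver q) (x y : constraintManifold q g) : Prop :=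
  ((y : EuclideanSpace ℝ (Fin n)), tangentialMove y x) ∈ S.success ∧
    S.target y (tangentialMove y x) = x

/-- The acceptance probability `P_a = min (1, f(y) p(v'|y) / (f(x) p(v|x)))` that the algorithm
computes. -/
def acceptProb (f : constraintManifold q g → ℝ≥0)
    (p : constraintManifold q g → EuclideanSpace ℝ (Fin n) → ℝ≥0)
    (x : constraintManifold q g) (v : EuclideanSpace ℝ (Fin n)) (y : constraintManifold q g) :
    ℝ≥0 :=
  min 1 (f y * p y (tangentialMove y x) / (f x * p x v))

/-- The move from `x` with tangential move `v` and uniform variate `u` is accepted. -/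
def MoveAccepted (S : ExactSolver q) (f : constraintManifold q g → ℝ≥0)
    (p : constraintManifold q g → EuclideanSpace ℝ (Fin n) → ℝ≥0)
    (x : constraintManifold q g) (ω : EuclideanSpace ℝ (Fin n) × ℝ) : Prop :=
  ProposalSucceeds S x ω.1 ∧ ω.2 ≤ acceptProb f p x ω.1 (propose S x ω.1) ∧
    ReverseProjectionSucceeds S x (propose S x ω.1)

open Classical in
/-- One step of the algorithm: `X_{k+1}` as a function of `X_k = x` and of the random input
`ω = (v, u)`. -/
def mcmcStep (S : ExactSolver q) (f : constraintManifold q g → ℝ≥0)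
    (p : constraintManifold q g → EuclideanSpace ℝ (Fin n) → ℝ≥0)
    (x : constraintManifold q g) (ω : EuclideanSpace ℝ (Fin n) × ℝ) : constraintManifold q g :=
  if MoveAccepted S f p x ω then propose S x ω.1 else x

/-- The law of the tangential move `v` from `x`: density `p(·|x)` on `T_x`. -/
def tangentLaw (p : constraintManifold q g → EuclideanSpace ℝ (Fin n) → ℝ≥0)
    (x : constraintManifold q g) : Measure (EuclideanSpace ℝ (Fin n)) :=
  (tangentVolume q x).withDensity fun v => (p x v : ℝ≥0∞)

/-- The law of the random input `(v, u)`: `v` and `u` are independent, `u` is uniform. -/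
def inputLaw (p : constraintManifold q g → EuclideanSpace ℝ (Fin n) → ℝ≥0)
    (x : constraintManifold q g) : Measure (EuclideanSpace ℝ (Fin n) × ℝ) :=
  (tangentLaw p x).prod (volume.restrict (Set.Icc (0 : ℝ) 1))

/-- `P_x`: the law of the proposed point. -/
def proposalLaw (S : ExactSolver q)
    (p : constraintManifold q g → EuclideanSpace ℝ (Fin n) → ℝ≥0)
    (x : constraintManifold q g) : Measure (constraintManifold q g) :=
  (tangentLaw p x).map (propose S x)

/-- `R_x`: the law of `X_{k+1}` given `X_k = x`. -/
def stepLaw (S : ExactSolver q) (f : constraintManifold q g → ℝ≥0)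
    (p : constraintManifold q g → EuclideanSpace ℝ (Fin n) → ℝ≥0)
    (x : constraintManifold q g) : Measure (constraintManifold q g) :=
  (inputLaw p x).map (mcmcStep S f p x)

/-- `ζ(x)`: the probability that the proposal phase fails. -/
def failureProb (S : ExactSolver q)
    (p : constraintManifold q g → EuclideanSpace ℝ (Fin n) → ℝ≥0)
    (x : constraintManifold q g) : ℝ≥0∞ :=
  tangentLaw p x {v | ¬ ProposalSucceeds S x v}

/-- `ξ(x)`: the overall probability of rejecting a move from `x`. -/
def rejectionProb (S : ExactSolver q) (f : constraintManifold q g → ℝ≥0)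
    (p : constraintManifold q g → EuclideanSpace ℝ (Fin n) → ℝ≥0)
    (x : constraintManifold q g) : ℝ≥0∞ :=
  inputLaw p x {ω | ¬ MoveAccepted S f p x ω}

/-! ### The densities -/

/-- `F_x`: the points of `M` that the solver cannot reach from `x`. -/
def unreachable (S : ExactSolver q) (x : constraintManifold q g) : Set (constraintManifold q g) :=
  {y | ¬ ∃ v ∈ tangentSpace q x, ((x : EuclideanSpace ℝ (Fin n)), v) ∈ S.success ∧
    S.target x v = y}

/-- `J(y|x) = |det (U_xᵗ U_y)|`, for orthonormal bases `U_x`, `U_y` of `T_x`, `T_y`. -/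
def jacobianFactor (x y : constraintManifold q g) : ℝ≥0 :=
  ‖Matrix.det (Matrix.of fun i j => inner ℝ (tangentFrame q x i) (tangentFrame q y j))‖₊

/-- The proposal density `h(y|x) = (1 - 1_{F_x}(y)) p(v|x) J(y|x)`. -/
def proposalDensity (S : ExactSolver q)
    (p : constraintManifold q g → EuclideanSpace ℝ (Fin n) → ℝ≥0)
    (x y : constraintManifold q g) : ℝ≥0 :=
  (1 - (unreachable S x).indicator 1 y) * p x (tangentialMove x y) * jacobianFactor x y

/-- The Metropolis–Hastings factor `a(y|x) = min (1, f(y) h(x|y) / (f(x) h(y|x)))`. -/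
def metropolisHastings (S : ExactSolver q) (f : constraintManifold q g → ℝ≥0)
    (p : constraintManifold q g → EuclideanSpace ℝ (Fin n) → ℝ≥0)
    (x y : constraintManifold q g) : ℝ≥0 :=
  min 1 (f y * proposalDensity S p y x / (f x * proposalDensity S p x y))

/-- The target `ρ(dx) = Z⁻¹ f(x) σ(dx)`, with `Z = ∫ f dσ`. -/
def targetMeasure (f : constraintManifold q g → ℝ≥0) : Measure (constraintManifold q g) :=
  (∫⁻ x, (f x : ℝ≥0∞) ∂surfaceMeasure q g)⁻¹ •
    (surfaceMeasure q g).withDensity fun x => (f x : ℝ≥0∞)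

end Algorithm

end

end ConstrainedMCMC

open ConstrainedMCMC

/-! The correction `Q_x a` is normal at `x`. A point `y` returned by the solver therefore determines
the tangential move that led to it: `v` is the projection of `y - x` onto `T_x`. So successful
proposals are injective on `T_x`, and their inverse on the reachable points is an orthogonal
projection, however irregular the solver may be. The image of Lebesgue measure of `T_x` under
successful proposals gives a set the volume of the projection of its reachable part
(`proposedVolume_apply`).

The area formula for this projection says that the image measure has density `J(·|x)` off `F_x`
(`proposedVolume_eq_withDensity`). No charts are used. Near `y`, the secants of `M` are almost
tangent (`exists_flatOn_constraintManifold`), so on small sets the projection to `T_x` is nearly the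
linear map `U_xᵗ U_y` and multiplies measure by nearly `J(y|x)`. Since `J` is continuous, these
local ratios determine the density (`eq_withDensity_of_local_ratio`). Weighting by `p` turns
integrals over moves into integrals against `h` (`setLIntegral_tangentLaw`), which gives the law of
the proposal.

For the step, the reverse check holds exactly when `x ∉ F_y`, so it supplies the indicator in
`h(x|y)`. As `J` is symmetric, it cancels from the quotient of densities. The computed acceptance
probability, combined with the check, thus agrees with `a(y|x)` wherever `h(y|x) ≠ 0`
(`acceptProb_mul_proposalDensity`). Finally `f(x) a(y|x) h(y|x)` is the minimum of `f(x) h(y|x)` and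
`f(y) h(x|y)`, which is symmetric. The atom at `x` affects only the diagonal, so reversibility
follows by Tonelli, and invariance from reversibility. -/

namespace ConstrainedMCMC

noncomputable section

/-! ### Hausdorff measure of nearly flat sets -/

theorem euclideanHausdorffMeasure_image_le_of_lipschitzOnWith {X Y : Type*} [MetricSpace X]
    [MeasurableSpace X] [BorelSpace X] [MetricSpace Y] [MeasurableSpace Y] [BorelSpace Y]
    {K : ℝ≥0} {φ : X → Y} {s : Set X} (h : LipschitzOnWith K φ s) (d : ℕ) :
    μHE[d] (φ '' s) ≤ (K : ℝ≥0∞) ^ d * μHE[d] s := by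
  have h1 := h.hausdorffMeasure_image_le (d := (d : ℝ)) (Nat.cast_nonneg d)
  rw [ENNReal.rpow_natCast] at h1
  rw [Measure.euclideanHausdorffMeasure_def, Measure.euclideanHausdorffMeasure_def,
    Measure.smul_apply, Measure.smul_apply, ENNReal.smul_def, ENNReal.smul_def, smul_eq_mul,
    smul_eq_mul, mul_left_comm]
  gcongr

section Flat

variable {F : Type*} [NormedAddCommGroup F] [InnerProductSpace ℝ F] [CompleteSpace F] {d : ℕ}

/-- The coordinates of the orthogonal projection onto the range of a linear isometry. -/
def isometryCoords (A : EuclideanSpace ℝ (Fin d) →ₗᵢ[ℝ] F) : F →L[ℝ] EuclideanSpace ℝ (Fin d) :=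
  ContinuousLinearMap.adjoint A.toContinuousLinearMap

theorem norm_isometryCoords_le (A : EuclideanSpace ℝ (Fin d) →ₗᵢ[ℝ] F) :
    ‖isometryCoords A‖ ≤ 1 := by
  unfold isometryCoords
  rw [LinearIsometryEquiv.norm_map]
  exact A.norm_toContinuousLinearMap_le

/-- Any secant of `s` deviates from the range of `A` by at most `δ` times its projection. -/
def FlatOn (A : EuclideanSpace ℝ (Fin d) →ₗᵢ[ℝ] F) (δ : ℝ≥0) (s : Set F) : Prop :=
  ∀ y ∈ s, ∀ z ∈ s, ‖(y - z) - A (isometryCoords A (y - z))‖ ≤ δ * ‖isometryCoords A (y - z)‖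

variable {A : EuclideanSpace ℝ (Fin d) →ₗᵢ[ℝ] F} {δ : ℝ≥0} {s t : Set F}

theorem FlatOn.mono (h : FlatOn A δ s) (hts : t ⊆ s) : FlatOn A δ t :=
  fun y hy z hz => h y (hts hy) z (hts hz)

theorem FlatOn.norm_sub_le (h : FlatOn A δ s) {y z : F} (hy : y ∈ s) (hz : z ∈ s) :
    ‖y - z‖ ≤ (1 + δ) * ‖isometryCoords A (y - z)‖ := by
  have h1 := h y hy z hz
  have h2 := norm_add_le (A (isometryCoords A (y - z)))
    ((y - z) - A (isometryCoords A (y - z)))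
  rw [add_sub_cancel, A.norm_map] at h2
  linarith

theorem FlatOn.injOn (h : FlatOn A δ s) : Set.InjOn (isometryCoords A) s := by
  intro y hy z hz hyz
  have h1 := h.norm_sub_le hy hz
  rw [map_sub, hyz, sub_self, norm_zero, mul_zero] at h1
  exact sub_eq_zero.1 (norm_le_zero_iff.1 h1)

/-- A flat set is a graph over its coordinates. The Lipschitz inverse bounds the measure of the set
by that of its shadow. -/
theorem FlatOn.lipschitzOnWith_invFunOn (h : FlatOn A δ s) [Nonempty F] :
    LipschitzOnWith (1 + δ) (Function.invFunOn (isometryCoords A) s) (isometryCoords A '' s) := by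
  refine LipschitzOnWith.of_dist_le_mul ?_
  rintro _ ⟨y, hy, rfl⟩ _ ⟨z, hz, rfl⟩
  rw [h.injOn.leftInvOn_invFunOn hy, h.injOn.leftInvOn_invFunOn hz, dist_eq_norm, dist_eq_norm,
    ← map_sub]
  exact_mod_cast h.norm_sub_le hy hz

/-- With `s` parametrized by its coordinates, the error is `B` applied to the deviation of a secant
from the range of `A`, and `B` is a contraction. This reduces the change of measure on `s` to that
of a nearly linear map of `ℝ^d`. -/
theorem FlatOn.approximatesLinearOn (h : FlatOn A δ s) {B : F →L[ℝ] EuclideanSpace ℝ (Fin d)}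
    (hB : ‖B‖ ≤ 1) :
    ApproximatesLinearOn (B ∘ Function.invFunOn (isometryCoords A) s)
      (B ∘L A.toContinuousLinearMap) (isometryCoords A '' s) δ := by
  rintro _ ⟨y, hy, rfl⟩ _ ⟨z, hz, rfl⟩
  simp only [Function.comp_apply, h.injOn.leftInvOn_invFunOn hy, h.injOn.leftInvOn_invFunOn hz]
  have h1 : B y - B z - (B ∘L A.toContinuousLinearMap) (isometryCoords A y - isometryCoords A z) =
      B ((y - z) - A (isometryCoords A (y - z))) := by
    simp only [map_sub, ContinuousLinearMap.comp_apply, LinearIsometry.coe_toContinuousLinearMap]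
  rw [h1, ← map_sub]
  calc _ ≤ ‖B‖ * ‖(y - z) - A (isometryCoords A (y - z))‖ := B.le_opNorm _
    _ ≤ 1 * ‖(y - z) - A (isometryCoords A (y - z))‖ := by gcongr
    _ ≤ _ := by rw [one_mul]; exact h y hy z hz

variable [MeasurableSpace F] [BorelSpace F]

theorem volume_isometryCoords_image_le (A : EuclideanSpace ℝ (Fin d) →ₗᵢ[ℝ] F) (s : Set F) :
    volume (isometryCoords A '' s) ≤ μHE[d] s := by
  have h1 : LipschitzOnWith 1 (isometryCoords A) s :=
    ((isometryCoords A).lipschitz.weaken (norm_isometryCoords_le A)).lipschitzOnWith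
  have h2 := euclideanHausdorffMeasure_image_le_of_lipschitzOnWith h1 d
  rwa [EuclideanSpace.euclideanHausdorffMeasure_eq_volume, ENNReal.coe_one, one_pow, one_mul] at h2

theorem FlatOn.euclideanHausdorffMeasure_le (h : FlatOn A δ s) :
    μHE[d] s ≤ ((1 + δ : ℝ≥0) : ℝ≥0∞) ^ d * volume (isometryCoords A '' s) := by
  have h1 := euclideanHausdorffMeasure_image_le_of_lipschitzOnWith h.lipschitzOnWith_invFunOn d
  rwa [h.injOn.leftInvOn_invFunOn.image_image,
    EuclideanSpace.euclideanHausdorffMeasure_eq_volume] at h1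

/-- On sufficiently flat sets, a linear contraction `B` multiplies measure by at most slightly more
than `|det (B A)|`. -/
theorem eventually_volume_image_le_of_det_lt (A : EuclideanSpace ℝ (Fin d) →ₗᵢ[ℝ] F)
    {B : F →L[ℝ] EuclideanSpace ℝ (Fin d)} (hB : ‖B‖ ≤ 1) {c : ℝ≥0}
    (hc : ENNReal.ofReal |(B ∘L A.toContinuousLinearMap).det| < c) :
    ∀ᶠ δ in 𝓝[>] (0 : ℝ≥0), ∀ s : Set F, FlatOn A δ s → volume (B '' s) ≤ c * μHE[d] s := by
  filter_upwards [addHaar_image_le_mul_of_det_lt volume _ hc] with δ hδ s hs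
  have h1 := hδ _ _ (hs.approximatesLinearOn hB)
  rw [Set.image_comp, hs.injOn.leftInvOn_invFunOn.image_image] at h1
  exact h1.trans (by gcongr; exact volume_isometryCoords_image_le A s)

/-- On sufficiently flat sets, a linear contraction `B` multiplies measure by at least slightly less
than `|det (B A)|`. -/
theorem eventually_le_volume_image_of_lt_det (A : EuclideanSpace ℝ (Fin d) →ₗᵢ[ℝ] F)
    {B : F →L[ℝ] EuclideanSpace ℝ (Fin d)} (hB : ‖B‖ ≤ 1) {c : ℝ≥0}
    (hc : (c : ℝ≥0∞) < ENNReal.ofReal |(B ∘L A.toContinuousLinearMap).det|) :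
    ∀ᶠ δ in 𝓝[>] (0 : ℝ≥0), ∀ s : Set F, FlatOn A δ s → c * μHE[d] s ≤ volume (B '' s) := by
  rw [ENNReal.ofReal, ENNReal.coe_lt_coe] at hc
  -- The gap between `c` and `c'` absorbs the factor `(1 + δ) ^ d` lost in passing from `s` to its
  -- shadow.
  obtain ⟨c', hc1, hc2⟩ := exists_between hc
  have hlim : Tendsto (fun δ : ℝ≥0 => c * (1 + δ) ^ d) (𝓝[>] 0) (𝓝 c) := by
    have : Continuous fun δ : ℝ≥0 => c * (1 + δ) ^ d := by fun_prop
    simpa using (this.tendsto 0).mono_left nhdsWithin_le_nhds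
  filter_upwards [mul_le_addHaar_image_of_lt_det volume _
    (show (c' : ℝ≥0∞) < ENNReal.ofReal |(B ∘L A.toContinuousLinearMap).det| by
      rwa [ENNReal.ofReal, ENNReal.coe_lt_coe]), hlim.eventually_lt_const hc1] with δ hδ hδ' s hs
  have h1 := hδ _ _ (hs.approximatesLinearOn hB)
  rw [Set.image_comp, hs.injOn.leftInvOn_invFunOn.image_image] at h1
  calc (c : ℝ≥0∞) * μHE[d] s
      ≤ c * (((1 + δ : ℝ≥0) : ℝ≥0∞) ^ d * volume (isometryCoords A '' s)) := by
        gcongr; exact hs.euclideanHausdorffMeasure_le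
    _ = (c * (1 + δ) ^ d : ℝ≥0) * volume (isometryCoords A '' s) := by
        rw [← mul_assoc]; push_cast; rfl
    _ ≤ c' * volume (isometryCoords A '' s) := by gcongr
    _ ≤ _ := h1

end Flat

/-! ### Recognizing a density from local bounds -/

section Density

variable {X : Type*} [TopologicalSpace X] [SecondCountableTopology X] [MeasurableSpace X]
  [OpensMeasurableSpace X]

/-- Countably many of the neighbourhoods cover the space; cutting a set along their disjointed
interiors reduces the inequality to the pieces. -/
theorem measure_le_of_locally_le {μ ν : Measure X}
    (h : ∀ x, ∃ U ∈ 𝓝 x, ∀ s ⊆ U, MeasurableSet s → μ s ≤ ν s) : μ ≤ ν := by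
  choose U hU hle using h
  obtain ⟨t, ht, hcov⟩ := TopologicalSpace.countable_cover_nhds fun x => interior_mem_nhds.2 (hU x)
  rcases t.eq_empty_or_nonempty with rfl | hne
  · have : IsEmpty X := Set.univ_eq_empty_iff.1 (by simpa using hcov.symm)
    exact (Measure.eq_zero_of_isEmpty μ).trans_le (Measure.zero_le ν)
  obtain ⟨e, rfl⟩ := ht.exists_eq_range hne
  have hm : ∀ k, MeasurableSet (disjointed (fun k => interior (U (e k))) k) :=
    fun k => MeasurableSet.disjointed (fun _ => isOpen_interior.measurableSet) k
  have hun : ⋃ k, disjointed (fun k => interior (U (e k))) k = Set.univ := by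
    rw [iUnion_disjointed]; simpa using hcov
  refine Measure.le_iff.2 fun s hs => ?_
  have hsplit : ∀ κ : Measure X, κ s = ∑' k, κ (s ∩ disjointed (fun k => interior (U (e k))) k) := by
    intro κ
    rw [← measure_iUnion (fun i j hij => (disjoint_disjointed _ hij).mono Set.inter_subset_right
      Set.inter_subset_right) (fun k => hs.inter (hm k)), ← Set.inter_iUnion, hun, Set.inter_univ]
  rw [hsplit μ, hsplit ν]
  exact ENNReal.tsum_le_tsum fun k => hle (e k) _
    (Set.inter_subset_right.trans ((disjointed_le _ k).trans interior_subset)) (hs.inter (hm k))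

/-- A measure whose ratio to `σ` on small sets near `x` is close to `J x`, where `J` is continuous,
has density `J` with respect to `σ`. -/
theorem eq_withDensity_of_local_ratio {σ ν : Measure X} [IsLocallyFiniteMeasure σ] {J : X → ℝ≥0}
    (hJ : Continuous J)
    (hle : ∀ x, ∀ c, J x < c → ∃ U ∈ 𝓝 x, ∀ s ⊆ U, MeasurableSet s → ν s ≤ c * σ s)
    (hge : ∀ x, ∀ c, c < J x → ∃ U ∈ 𝓝 x, ∀ s ⊆ U, MeasurableSet s → c * σ s ≤ ν s) :
    ν = σ.withDensity fun x => (J x : ℝ≥0∞) := by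
  have hJm : Measurable fun x => (J x : ℝ≥0∞) := hJ.measurable.coe_nnreal_ennreal
  have h1 : ∀ ε : ℝ≥0, 0 < ε → ν ≤ σ.withDensity (fun x => (J x : ℝ≥0∞)) + (ε : ℝ≥0∞) • σ := by
    intro ε hε
    refine measure_le_of_locally_le fun x => ?_
    -- Half of `ε` is spent on the ratio of the measures, half on the oscillation of `J` near `x`.
    obtain ⟨U, hU, hb⟩ := hle x (J x + ε / 2) (lt_add_of_pos_right _ (half_pos hε))
    have hV : {y | J x < J y + ε / 2} ∈ 𝓝 x :=
      (isOpen_lt continuous_const (by fun_prop)).mem_nhds (lt_add_of_pos_right _ (half_pos hε))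
    refine ⟨U ∩ {y | J x < J y + ε / 2}, inter_mem hU hV, fun s hs hsm => ?_⟩
    calc ν s ≤ ((J x + ε / 2 : ℝ≥0) : ℝ≥0∞) * σ s := hb s (hs.trans Set.inter_subset_left) hsm
      _ = ∫⁻ _ in s, ((J x + ε / 2 : ℝ≥0) : ℝ≥0∞) ∂σ := (setLIntegral_const _ _).symm
      _ ≤ ∫⁻ y in s, ((J y : ℝ≥0∞) + ε) ∂σ := by
          refine setLIntegral_mono (hJm.add_const _) fun y hy => ?_
          have h2 : J x < J y + ε / 2 := (hs hy).2
          have h3 : J x + ε / 2 ≤ J y + ε := by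
            calc J x + ε / 2 ≤ J y + ε / 2 + ε / 2 := by gcongr
              _ = J y + ε := by rw [add_assoc, add_halves]
          exact_mod_cast h3
      _ = _ := by
          rw [lintegral_add_left hJm, setLIntegral_const, Measure.add_apply, Measure.smul_apply,
            withDensity_apply _ hsm, smul_eq_mul]
  have h2 : ∀ ε : ℝ≥0, 0 < ε → σ.withDensity (fun x => (J x : ℝ≥0∞)) ≤ ν + (ε : ℝ≥0∞) • σ := by
    intro ε hε
    refine measure_le_of_locally_le fun x => ?_
    obtain ⟨U, hU, hb⟩ : ∃ U ∈ 𝓝 x, ∀ s ⊆ U, MeasurableSet s →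
        ((J x - ε / 2 : ℝ≥0) : ℝ≥0∞) * σ s ≤ ν s := by
      -- Subtraction is truncated: at `J x = 0` no constant lies strictly below `J x`, but the bound
      -- is trivial.
      rcases eq_or_ne (J x) 0 with h0 | h0
      · exact ⟨Set.univ, univ_mem, fun s _ _ => by simp [h0]⟩
      · exact hge x _ (tsub_lt_self (pos_iff_ne_zero.2 h0) (half_pos hε))
    have hV : {y | J y < J x + ε / 2} ∈ 𝓝 x :=
      (isOpen_lt (by fun_prop) continuous_const).mem_nhds (lt_add_of_pos_right _ (half_pos hε))
    refine ⟨U ∩ {y | J y < J x + ε / 2}, inter_mem hU hV, fun s hs hsm => ?_⟩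
    calc σ.withDensity (fun x => (J x : ℝ≥0∞)) s = ∫⁻ y in s, (J y : ℝ≥0∞) ∂σ :=
          withDensity_apply _ hsm
      _ ≤ ∫⁻ _ in s, (((J x - ε / 2 : ℝ≥0) : ℝ≥0∞) + ε) ∂σ := by
          refine setLIntegral_mono measurable_const fun y hy => ?_
          have h2 : J y < J x + ε / 2 := (hs hy).2
          have h3 : J y ≤ (J x - ε / 2) + ε := by
            calc J y ≤ J x + ε / 2 := h2.le
              _ ≤ (J x - ε / 2 + ε / 2) + ε / 2 := by gcongr; exact le_tsub_add
              _ = _ := by rw [add_assoc, add_halves]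
          exact_mod_cast h3
      _ = ((J x - ε / 2 : ℝ≥0) : ℝ≥0∞) * σ s + ε * σ s := by rw [setLIntegral_const, add_mul]
      _ ≤ _ := by
          rw [Measure.add_apply, Measure.smul_apply, smul_eq_mul]
          gcongr
          exact hb s (hs.trans Set.inter_subset_left) hsm
  have h3 : ∀ {μ₁ μ₂ : Measure X}, (∀ ε : ℝ≥0, 0 < ε → μ₁ ≤ μ₂ + (ε : ℝ≥0∞) • σ) →
      ∀ s, σ s ≠ ⊤ → μ₁ s ≤ μ₂ s := by
    intro μ₁ μ₂ h s hs
    have hlim : Tendsto (fun ε : ℝ≥0 => μ₂ s + (ε : ℝ≥0∞) * σ s) (𝓝[>] 0) (𝓝 (μ₂ s)) := by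
      have h4 : Tendsto (fun ε : ℝ≥0 => (ε : ℝ≥0∞) * σ s) (𝓝 0) (𝓝 ((0 : ℝ≥0) * σ s)) :=
        ENNReal.Tendsto.mul_const (ENNReal.tendsto_coe.2 tendsto_id) (Or.inr hs)
      simpa using (tendsto_const_nhds.add h4).mono_left nhdsWithin_le_nhds
    refine ge_of_tendsto hlim ?_
    filter_upwards [self_mem_nhdsWithin] with ε hε
    exact (h ε hε) s
  -- Letting `ε` tend to `0` in `ε * σ s` requires `σ s` to be finite, hence the restriction to
  -- spanning sets.
  rw [Measure.ext_iff_of_iUnion_eq_univ (iUnion_spanningSets σ)]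
  intro k
  refine Measure.ext fun s hs => ?_
  rw [Measure.restrict_apply hs, Measure.restrict_apply hs]
  have hfin : σ (s ∩ spanningSets σ k) ≠ ⊤ :=
    ((measure_mono Set.inter_subset_right).trans_lt (measure_spanningSets_lt_top σ k)).ne
  exact le_antisymm (h3 h1 _ hfin) (h3 h2 _ hfin)

end Density

/-! ### Tangent spaces -/

section Tangent

variable {n m l : ℕ} {q : Fin m → EuclideanSpace ℝ (Fin n) → ℝ}
  {g : Fin l → EuclideanSpace ℝ (Fin n) → ℝ}

theorem mem_tangentSpace_iff {x v : EuclideanSpace ℝ (Fin n)} :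
    v ∈ tangentSpace q x ↔ ∀ i, inner ℝ (gradient (q i) x) v = 0 := by
  constructor
  · intro h i
    exact h _ (Submodule.subset_span ⟨i, rfl⟩)
  · intro h u hu
    induction hu using Submodule.span_induction with
    | mem u hu => obtain ⟨i, rfl⟩ := hu; exact h i
    | zero => exact inner_zero_left _
    | add a b _ _ ha hb => rw [inner_add_left, ha, hb, add_zero]
    | smul r a _ ha => rw [inner_smul_left, ha, mul_zero]

theorem normalMove_mem_orthogonal (x : EuclideanSpace ℝ (Fin n)) (a : EuclideanSpace ℝ (Fin m)) :
    normalMove q x a ∈ (tangentSpace q x)ᗮ :=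
  Submodule.le_orthogonal_orthogonal _ (Submodule.sum_mem _ fun j _ =>
    Submodule.smul_mem _ _ (Submodule.subset_span ⟨j, rfl⟩))

theorem tangentPart_mem (x z : EuclideanSpace ℝ (Fin n)) :
    tangentPart q x z ∈ tangentSpace q x :=
  Submodule.starProjection_apply_mem _ z

theorem tangentPart_eq_of_sub_mem {x z v : EuclideanSpace ℝ (Fin n)} (hv : v ∈ tangentSpace q x)
    (h : z - v ∈ (tangentSpace q x)ᗮ) : tangentPart q x z = v :=
  Submodule.eq_starProjection_of_mem_orthogonal hv h

theorem finrank_tangentSpace {x : EuclideanSpace ℝ (Fin n)}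
    (hx : LinearIndependent ℝ fun i => gradient (q i) x) :
    Module.finrank ℝ (tangentSpace q x) = n - m := by
  have h1 := Submodule.finrank_add_finrank_orthogonal
    (Submodule.span ℝ (Set.range fun j => gradient (q j) x))
  rw [finrank_span_eq_card hx, finrank_euclideanSpace_fin, Fintype.card_fin] at h1
  unfold tangentSpace
  omega

/-- The linear isometry of `ℝ^d` onto the tangent space given by `tangentFrame`. -/
def tangentIsometry (x : EuclideanSpace ℝ (Fin n))
    (hx : LinearIndependent ℝ fun i => gradient (q i) x) :
    EuclideanSpace ℝ (Fin (n - m)) →ₗᵢ[ℝ] EuclideanSpace ℝ (Fin n) :=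
  (tangentSpace q x).subtypeₗᵢ.comp
    (((stdOrthonormalBasis ℝ (tangentSpace q x)).reindex
      (finCongr (finrank_tangentSpace hx))).repr.symm.toLinearIsometry)

theorem tangentIsometry_apply {x : EuclideanSpace ℝ (Fin n)}
    (hx : LinearIndependent ℝ fun i => gradient (q i) x) (c : EuclideanSpace ℝ (Fin (n - m))) :
    tangentIsometry x hx c = ∑ i, c i • tangentFrame q x i := by
  have h1 := ((stdOrthonormalBasis ℝ (tangentSpace q x)).reindex
      (finCongr (finrank_tangentSpace hx))).sum_repr_symm c
  change ((((stdOrthonormalBasis ℝ (tangentSpace q x)).reindex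
      (finCongr (finrank_tangentSpace hx))).repr.symm c : tangentSpace q x) :
      EuclideanSpace ℝ (Fin n)) = _
  rw [← h1, Submodule.coe_sum]
  simp only [tangentFrame, finrank_tangentSpace hx, dif_pos, Submodule.coe_smul]

theorem tangentIsometry_mem {x : EuclideanSpace ℝ (Fin n)}
    (hx : LinearIndependent ℝ fun i => gradient (q i) x) (c : EuclideanSpace ℝ (Fin (n - m))) :
    tangentIsometry x hx c ∈ tangentSpace q x :=
  Subtype.coe_prop _

theorem exists_tangentIsometry_eq {x v : EuclideanSpace ℝ (Fin n)}
    (hx : LinearIndependent ℝ fun i => gradient (q i) x) (hv : v ∈ tangentSpace q x) :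
    ∃ c, tangentIsometry x hx c = v :=
  ⟨((stdOrthonormalBasis ℝ (tangentSpace q x)).reindex
      (finCongr (finrank_tangentSpace hx))).repr ⟨v, hv⟩, by simp [tangentIsometry]⟩

theorem tangentVolume_eq_map {x : EuclideanSpace ℝ (Fin n)}
    (hx : LinearIndependent ℝ fun i => gradient (q i) x) :
    tangentVolume q x = Measure.map (tangentIsometry x hx) volume := by
  unfold tangentVolume
  congr 1
  ext1 c
  exact (tangentIsometry_apply hx c).symm

/-- For a linear isometry `A`, the product of `A` and its adjoint is the orthogonal projection onto
the range. -/
theorem tangentIsometry_isometryCoords {x : EuclideanSpace ℝ (Fin n)}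
    (hx : LinearIndependent ℝ fun i => gradient (q i) x) (z : EuclideanSpace ℝ (Fin n)) :
    tangentIsometry x hx (isometryCoords (tangentIsometry x hx) z) = tangentPart q x z := by
  refine (tangentPart_eq_of_sub_mem (tangentIsometry_mem hx _) fun u hu => ?_).symm
  obtain ⟨c, rfl⟩ := exists_tangentIsometry_eq hx hu
  rw [inner_sub_right, LinearIsometry.inner_map_map, isometryCoords,
    ContinuousLinearMap.adjoint_inner_right]
  exact sub_self _

/-- On `M` the orthogonal projection onto the tangent space depends continuously on the point. -/
theorem continuous_tangentPart (hq : ∀ i, ContDiff ℝ (⊤ : ℕ∞) (q i))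
    (hrank : ∀ x ∈ constraintManifold q g, LinearIndependent ℝ fun i => gradient (q i) x) :
    Continuous fun w : constraintManifold q g × EuclideanSpace ℝ (Fin n) =>
      tangentPart q (w.1 : EuclideanSpace ℝ (Fin n)) w.2 := by
  have hgrad : ∀ i, Continuous fun w : constraintManifold q g × EuclideanSpace ℝ (Fin n) =>
      gradient (q i) (w.1 : EuclideanSpace ℝ (Fin n)) :=
    fun i => (continuous_gradient hq i).comp (continuous_subtype_val.comp continuous_fst)
  -- The projection of `z` is `z - Q (QᵗQ)⁻¹ Qᵗ z`. The Gram matrix `QᵗQ` is invertible on `M`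
  -- because the gradients are independent, so its inverse is continuous there.
  let G : constraintManifold q g × EuclideanSpace ℝ (Fin n) → Matrix (Fin m) (Fin m) ℝ :=
    fun w => Matrix.gram ℝ fun i => gradient (q i) (w.1 : EuclideanSpace ℝ (Fin n))
  have hdet : ∀ w, (G w).det ≠ 0 := fun w =>
    Matrix.det_gram_ne_zero_iff_linearIndependent.2 (hrank w.1 w.1.2)
  have hG : Continuous G := continuous_matrix fun i j => (hgrad i).inner (hgrad j)
  have hGinv : Continuous fun w => (G w)⁻¹ := by
    simp only [Matrix.inv_def, Ring.inverse_eq_inv']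
    exact (hG.matrix_det.inv₀ hdet).smul hG.matrix_adjugate
  let a : constraintManifold q g × EuclideanSpace ℝ (Fin n) → Fin m → ℝ := fun w =>
    Matrix.mulVec (G w)⁻¹ fun i => inner ℝ (gradient (q i) (w.1 : EuclideanSpace ℝ (Fin n))) w.2
  have ha : Continuous a :=
    hGinv.matrix_mulVec (continuous_pi fun i => (hgrad i).inner continuous_snd)
  have hkey : ∀ w : constraintManifold q g × EuclideanSpace ℝ (Fin n),
      tangentPart q (w.1 : EuclideanSpace ℝ (Fin n)) w.2 =
        w.2 - normalMove q (w.1 : EuclideanSpace ℝ (Fin n)) (WithLp.toLp 2 (a w)) := by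
    intro w
    refine tangentPart_eq_of_sub_mem (mem_tangentSpace_iff.2 fun i => ?_) ?_
    · have h1 : Matrix.mulVec (G w) (a w) =
          fun i => inner ℝ (gradient (q i) (w.1 : EuclideanSpace ℝ (Fin n))) w.2 := by
        rw [Matrix.mulVec_mulVec, Matrix.mul_nonsing_inv _ (isUnit_iff_ne_zero.2 (hdet w)),
          Matrix.one_mulVec]
      have h2 := congrFun h1 i
      rw [inner_sub_right, ← h2, normalMove, inner_sum, sub_eq_zero, Matrix.mulVec, dotProduct]
      refine Finset.sum_congr rfl fun j _ => ?_
      rw [inner_smul_right, mul_comm]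
      rfl
    · rw [sub_sub_cancel]
      exact normalMove_mem_orthogonal _ _
  simp only [hkey, normalMove]
  exact continuous_snd.sub (continuous_finsetSum _ fun j _ =>
    ((continuous_apply j).comp ha).smul (hgrad j))

/-! ### The Jacobian factor -/

theorem inner_tangentFrame {x : EuclideanSpace ℝ (Fin n)}
    (hx : LinearIndependent ℝ fun i => gradient (q i) x) (i j : Fin (n - m)) :
    inner ℝ (tangentFrame q x i) (tangentFrame q x j) = if i = j then (1 : ℝ) else 0 := by
  simp only [tangentFrame, finrank_tangentSpace hx, dif_pos, ← Submodule.coe_inner]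
  exact orthonormal_iff_ite.1 (OrthonormalBasis.orthonormal _) i j

theorem tangentIsometry_single {x : EuclideanSpace ℝ (Fin n)}
    (hx : LinearIndependent ℝ fun i => gradient (q i) x) (i : Fin (n - m)) :
    tangentIsometry x hx (EuclideanSpace.single i 1) = tangentFrame q x i := by
  rw [tangentIsometry_apply]
  simp [PiLp.single_apply]

/-- In the standard basis, the adjoint of one tangent isometry composed with the other has matrix
`U_xᵗ U_y`. This is the determinant met in the flat estimates. -/
theorem jacobianFactor_eq_det {x y : constraintManifold q g}
    (hx : LinearIndependent ℝ fun i => gradient (q i) (x : EuclideanSpace ℝ (Fin n)))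
    (hy : LinearIndependent ℝ fun i => gradient (q i) (y : EuclideanSpace ℝ (Fin n))) :
    (jacobianFactor x y : ℝ≥0∞) = ENNReal.ofReal |(isometryCoords (tangentIsometry _ hx) ∘L
      (tangentIsometry _ hy).toContinuousLinearMap).det| := by
  rw [← Real.norm_eq_abs, ofReal_norm, jacobianFactor, ← enorm_eq_nnnorm,
    ContinuousLinearMap.det, ← LinearMap.det_toMatrix (EuclideanSpace.basisFun _ ℝ).toBasis]
  congr 2
  ext i j
  rw [LinearMap.toMatrix_apply]
  simp only [Matrix.of_apply, OrthonormalBasis.coe_toBasis, EuclideanSpace.basisFun_apply,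
    OrthonormalBasis.coe_toBasis_repr_apply, EuclideanSpace.basisFun_repr]
  rw [← tangentIsometry_single hx, ← tangentIsometry_single hy]
  have h1 := ContinuousLinearMap.adjoint_inner_right (tangentIsometry _ hx).toContinuousLinearMap
    (EuclideanSpace.single i 1) (tangentIsometry _ hy (EuclideanSpace.single j 1))
  rw [EuclideanSpace.inner_single_left, map_one, one_mul] at h1
  exact h1.symm

theorem jacobianFactor_comm (x y : constraintManifold q g) :
    jacobianFactor x y = jacobianFactor y x := by
  unfold jacobianFactor
  rw [← Matrix.det_transpose]
  congr 2
  ext i j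
  simp [real_inner_comm]

/-- The matrix of the orthogonal projection onto the tangent space. -/
def tangentProjMatrix (q : Fin m → EuclideanSpace ℝ (Fin n) → ℝ) (x : EuclideanSpace ℝ (Fin n)) :
    Matrix (Fin n) (Fin n) ℝ :=
  Matrix.of fun i j => tangentPart q x (EuclideanSpace.single j 1) i

/-- The matrix whose columns are the vectors of the orthonormal basis of the tangent space. -/
def tangentFrameMatrix (q : Fin m → EuclideanSpace ℝ (Fin n) → ℝ) (x : EuclideanSpace ℝ (Fin n)) :
    Matrix (Fin n) (Fin (n - m)) ℝ :=
  Matrix.of fun i j => tangentFrame q x j i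

theorem tangentFrameMatrix_mul_transpose {x : EuclideanSpace ℝ (Fin n)}
    (hx : LinearIndependent ℝ fun i => gradient (q i) x) :
    tangentFrameMatrix q x * (tangentFrameMatrix q x).transpose = tangentProjMatrix q x := by
  ext i j
  rw [tangentProjMatrix, Matrix.of_apply, ← tangentIsometry_isometryCoords hx,
    tangentIsometry_apply, Matrix.mul_apply, WithLp.ofLp_sum, Finset.sum_apply]
  refine Finset.sum_congr rfl fun k _ => ?_
  have h1 := ContinuousLinearMap.adjoint_inner_right (tangentIsometry _ hx).toContinuousLinearMap
    (EuclideanSpace.single k 1) (EuclideanSpace.single j 1)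
  rw [EuclideanSpace.inner_single_left, map_one, one_mul] at h1
  rw [isometryCoords, h1, LinearIsometry.coe_toContinuousLinearMap, tangentIsometry_single,
    EuclideanSpace.inner_single_right]
  simp [tangentFrameMatrix, mul_comm]

theorem tangentFrameMatrix_transpose_mul (x y : EuclideanSpace ℝ (Fin n)) :
    (tangentFrameMatrix q x).transpose * tangentFrameMatrix q y =
      Matrix.of fun i j => inner ℝ (tangentFrame q x i) (tangentFrame q y j) := by
  ext i j
  simp [Matrix.mul_apply, tangentFrameMatrix, PiLp.inner_apply, mul_comm]

/-- The frames are chosen arbitrarily at each point, whereas the projections `P = U Uᵗ` vary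
continuously; this formula involves only the latter. The identity `det (1 + U C) = det (1 + C U)`
and `UᵗU = 1` reduce the large determinant to that of `UᵗV VᵗU`, which is `det (UᵗV) ^ 2`. -/
theorem jacobianFactor_eq_sqrt {x y : constraintManifold q g}
    (hx : LinearIndependent ℝ fun i => gradient (q i) (x : EuclideanSpace ℝ (Fin n)))
    (hy : LinearIndependent ℝ fun i => gradient (q i) (y : EuclideanSpace ℝ (Fin n))) :
    jacobianFactor x y = Real.toNNReal (Real.sqrt (1 +
      (tangentProjMatrix q x * tangentProjMatrix q y * tangentProjMatrix q x -
        tangentProjMatrix q x)).det) := by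
  set U := tangentFrameMatrix q (x : EuclideanSpace ℝ (Fin n)) with hU
  set V := tangentFrameMatrix q (y : EuclideanSpace ℝ (Fin n)) with hV
  have hUU : U.transpose * U = 1 := by
    rw [hU, tangentFrameMatrix_transpose_mul]
    ext i j
    rw [Matrix.of_apply, inner_tangentFrame hx, Matrix.one_apply]
  have h1 : (1 + (tangentProjMatrix q x * tangentProjMatrix q y * tangentProjMatrix q x -
      tangentProjMatrix q x)).det = (U.transpose * V).det ^ 2 := by
    rw [← tangentFrameMatrix_mul_transpose hx, ← tangentFrameMatrix_mul_transpose hy, ← hU, ← hV]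
    have h2 : U * U.transpose * (V * V.transpose) * (U * U.transpose) - U * U.transpose =
        U * ((U.transpose * V * (V.transpose * U) - 1) * U.transpose) := by
      simp only [Matrix.sub_mul, Matrix.mul_sub, Matrix.mul_assoc, Matrix.one_mul]
    rw [h2, Matrix.det_one_add_mul_comm, Matrix.mul_assoc, hUU, Matrix.mul_one,
      add_sub_cancel, Matrix.det_mul, sq, ← Matrix.det_transpose (V.transpose * U),
      Matrix.transpose_mul, Matrix.transpose_transpose]
  rw [h1, Real.sqrt_sq_eq_abs, jacobianFactor, ← tangentFrameMatrix_transpose_mul,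
    ← Real.norm_eq_abs, norm_toNNReal]

theorem continuous_tangentProjMatrix (hq : ∀ i, ContDiff ℝ (⊤ : ℕ∞) (q i))
    (hrank : ∀ x ∈ constraintManifold q g, LinearIndependent ℝ fun i => gradient (q i) x) :
    Continuous fun x : constraintManifold q g =>
      tangentProjMatrix q (x : EuclideanSpace ℝ (Fin n)) := by
  refine continuous_matrix fun i j => ?_
  have h2 : Continuous fun x : constraintManifold q g =>
      (x, (EuclideanSpace.single j 1 : EuclideanSpace ℝ (Fin n))) :=
    continuous_id.prodMk continuous_const
  have h3 := (continuous_tangentPart hq hrank).comp h2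
  exact (PiLp.continuous_apply 2 (fun _ : Fin n => ℝ) i).comp h3

theorem continuous_jacobianFactor (hq : ∀ i, ContDiff ℝ (⊤ : ℕ∞) (q i))
    (hrank : ∀ x ∈ constraintManifold q g, LinearIndependent ℝ fun i => gradient (q i) x) :
    Continuous fun w : constraintManifold q g × constraintManifold q g =>
      jacobianFactor w.1 w.2 := by
  have h1 : ∀ w : constraintManifold q g × constraintManifold q g, _ :=
    fun w => jacobianFactor_eq_sqrt (hrank w.1 w.1.2) (hrank w.2 w.2.2)
  simp only [h1]
  have h2 := continuous_tangentProjMatrix hq hrank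
  have h4 : Continuous fun w : constraintManifold q g × constraintManifold q g =>
      tangentProjMatrix q (w.1 : EuclideanSpace ℝ (Fin n)) := h2.comp continuous_fst
  have h5 : Continuous fun w : constraintManifold q g × constraintManifold q g =>
      tangentProjMatrix q (w.2 : EuclideanSpace ℝ (Fin n)) := h2.comp continuous_snd
  have h6 := ((h4.matrix_mul h5).matrix_mul h4).sub h4
  have h7 := (continuous_const.add h6 : Continuous fun w => (1 : Matrix (Fin n) (Fin n) ℝ) + _)
  exact continuous_real_toNNReal.comp (Real.continuous_sqrt.comp h7.matrix_det)

/-! ### Local flatness of the manifold -/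

/-- The derivatives of the constraints control the norm of normal vectors. -/
theorem exists_norm_le_mul_norm_gradients (y₀ : EuclideanSpace ℝ (Fin n)) :
    ∃ K : ℝ≥0, 0 < K ∧ ∀ r ∈ (tangentSpace q y₀)ᗮ,
      ‖r‖ ≤ K * ‖fun i => fderiv ℝ (q i) y₀ r‖ := by
  let L : EuclideanSpace ℝ (Fin n) →ₗ[ℝ] Fin m → ℝ :=
    LinearMap.pi fun i => (fderiv ℝ (q i) y₀).toLinearMap
  obtain ⟨K, hK, hanti⟩ := LinearMap.exists_antilipschitzWith
    (L.domRestrict (tangentSpace q y₀)ᗮ) (by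
      rw [LinearMap.ker_eq_bot']
      rintro ⟨w, hw⟩ h0
      -- A normal vector killed by all the derivatives is also tangent, hence orthogonal to itself.
      -- Injectivity gives the constant `K` in finite dimension.
      have h1 : w ∈ tangentSpace q y₀ := mem_tangentSpace_iff.2 fun i => by
        rw [gradient, InnerProductSpace.toDual_symm_apply]
        exact congrFun h0 i
      have h2 : inner ℝ w w = (0 : ℝ) := hw w h1
      exact Subtype.ext (inner_self_eq_zero.1 h2))
  refine ⟨K, hK, fun r hr => ?_⟩
  have h5 := hanti.le_mul_dist ⟨r, hr⟩ 0
  rw [map_zero, dist_zero_right, dist_zero_right] at h5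
  exact h5

/-- Near each of its points, the zero set of `q` is as flat as desired. -/
theorem exists_flatOn_constraintManifold (hq : ∀ i, ContDiff ℝ (⊤ : ℕ∞) (q i))
    {y₀ : EuclideanSpace ℝ (Fin n)} (hy₀ : LinearIndependent ℝ fun i => gradient (q i) y₀)
    {δ : ℝ≥0} (hδ : 0 < δ) :
    ∃ U ∈ 𝓝 y₀, FlatOn (tangentIsometry y₀ hy₀) δ (constraintManifold q g ∩ U) := by
  have hΦ : HasStrictFDerivAt (fun y i => q i y)
      (ContinuousLinearMap.pi fun i => fderiv ℝ (q i) y₀) y₀ :=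
    hasStrictFDerivAt_pi.2 fun i => (hq i).contDiffAt.hasStrictFDerivAt (by simp)
  obtain ⟨K, hK, hN⟩ := exists_norm_le_mul_norm_gradients (q := q) y₀
  -- Chosen so that `‖r‖ ≤ K ε (‖t‖ + ‖r‖)` amounts to `‖r‖ ≤ δ ‖t‖`, for the normal part `r` and
  -- the tangential part `t` of a secant.
  obtain ⟨ε, hε⟩ : ∃ ε : ℝ≥0, ε = δ / (K * (1 + δ)) := ⟨_, rfl⟩
  have hεpos : 0 < ε := by rw [hε]; positivity
  have h8 : (K : ℝ) * ε * (1 + δ) = δ := by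
    have hK' : (K : ℝ) ≠ 0 := by exact_mod_cast hK.ne'
    have : (1 + δ : ℝ) ≠ 0 := by positivity
    rw [hε]; push_cast
    field_simp
  obtain ⟨U, hU, happ⟩ := hΦ.approximates_deriv_on_nhds (Or.inr hεpos)
  refine ⟨U, hU, fun y hy z hz => ?_⟩
  have h2 := happ y hy.2 z hz.2
  have hnorm : ‖isometryCoords (tangentIsometry y₀ hy₀) (y - z)‖ = ‖tangentPart q y₀ (y - z)‖ := by
    rw [← tangentIsometry_isometryCoords hy₀, LinearIsometry.norm_map]
  rw [tangentIsometry_isometryCoords, hnorm]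
  have htT : tangentPart q y₀ (y - z) ∈ tangentSpace q y₀ := tangentPart_mem _ _
  have h4 := hN (y - z - tangentPart q y₀ (y - z)) (Submodule.sub_starProjection_mem_orthogonal _)
  have h6 := norm_add_le (tangentPart q y₀ (y - z)) (y - z - tangentPart q y₀ (y - z))
  rw [add_sub_cancel] at h6
  generalize tangentPart q y₀ (y - z) = t at *
  -- The constraints vanish at both ends of the secant and their derivatives kill `t`, so the error
  -- in strict differentiability is the derivative along the normal part.
  have h1 : ‖fun i => fderiv ℝ (q i) y₀ (y - z - t)‖ ≤ ε * ‖y - z‖ := by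
    rw [← norm_neg] at h2
    refine (congrArg norm (funext fun i => ?_)).trans_le h2
    have h3 := mem_tangentSpace_iff.1 htT i
    rw [gradient, InnerProductSpace.toDual_symm_apply] at h3
    simp [hy.1.1 i, hz.1.1 i, h3]
  generalize y - z - t = r at *
  have h7 : ‖r‖ ≤ K * (ε * (‖t‖ + ‖r‖)) :=
    h4.trans (by gcongr; exact h1.trans (by gcongr))
  have hδ0 : (0 : ℝ) ≤ δ := δ.2
  have h9 := mul_le_mul_of_nonneg_right h7 (add_nonneg zero_le_one hδ0)
  have h10 : (K : ℝ) * (ε * (‖t‖ + ‖r‖)) * (1 + δ) = δ * (‖t‖ + ‖r‖) := by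
    linear_combination (‖t‖ + ‖r‖) * h8
  linarith

end Tangent

/-! ### The area formula for the projection onto a tangent space -/

section Area

variable {n m l : ℕ} {q : Fin m → EuclideanSpace ℝ (Fin n) → ℝ}
  {g : Fin l → EuclideanSpace ℝ (Fin n) → ℝ}

theorem surfaceMeasure_apply (s : Set (constraintManifold q g)) :
    surfaceMeasure q g s = μHE[n - m] ((↑) '' s : Set (EuclideanSpace ℝ (Fin n))) :=
  (isometry_subtype_coe.euclideanHausdorffMeasure_image s).symm

/-- Flatness with `δ = 1` suffices: a bounded piece has at most `2 ^ d` times the measure of its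
bounded shadow. -/
theorem isLocallyFiniteMeasure_surfaceMeasure (hq : ∀ i, ContDiff ℝ (⊤ : ℕ∞) (q i))
    (hrank : ∀ x ∈ constraintManifold q g, LinearIndependent ℝ fun i => gradient (q i) x) :
    IsLocallyFiniteMeasure (surfaceMeasure q g) := by
  refine ⟨fun y => ?_⟩
  obtain ⟨U, hU, hflat⟩ := exists_flatOn_constraintManifold (g := g) hq (hrank y y.2) one_pos
  have hV : U ∩ Metric.ball (y : EuclideanSpace ℝ (Fin n)) 1 ∈ 𝓝 (y : EuclideanSpace ℝ (Fin n)) :=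
    inter_mem hU (Metric.ball_mem_nhds _ one_pos)
  refine ⟨Subtype.val ⁻¹' (U ∩ Metric.ball (y : EuclideanSpace ℝ (Fin n)) 1),
    continuous_subtype_val.continuousAt.preimage_mem_nhds hV, ?_⟩
  rw [surfaceMeasure_apply, Subtype.image_preimage_coe]
  have hsub : constraintManifold q g ∩ (U ∩ Metric.ball (y : EuclideanSpace ℝ (Fin n)) 1) ⊆
      constraintManifold q g ∩ U := Set.inter_subset_inter_right _ Set.inter_subset_left
  refine (hflat.mono hsub).euclideanHausdorffMeasure_le.trans_lt (ENNReal.mul_lt_top (by simp) ?_)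
  refine Bornology.IsBounded.measure_lt_top ?_
  exact (isometryCoords _).lipschitz.isBounded_image
    (Metric.isBounded_ball.subset (Set.inter_subset_right.trans Set.inter_subset_right))

/-! ### Reachable points and their tangential moves -/

theorem measurable_target (hq : ∀ i, ContDiff ℝ (⊤ : ℕ∞) (q i)) (S : ExactSolver q) :
    Measurable fun z : EuclideanSpace ℝ (Fin n) × EuclideanSpace ℝ (Fin n) => S.target z.1 z.2 :=
  measurable_move hq S.measurable_coeff

theorem tangentPart_target_sub (S : ExactSolver q) {x v : EuclideanSpace ℝ (Fin n)}
    (hv : v ∈ tangentSpace q x) : tangentPart q x (S.target x v - x) = v := by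
  refine tangentPart_eq_of_sub_mem hv ?_
  rw [ExactSolver.target, add_assoc, add_sub_cancel_left, add_sub_cancel_left]
  exact normalMove_mem_orthogonal _ _

theorem tangentialMove_mem (x y : constraintManifold q g) :
    tangentialMove x y ∈ tangentSpace q (x : EuclideanSpace ℝ (Fin n)) :=
  tangentPart_mem _ _

/-- The only move in `T_y` that can lead to `x` is the projection of `x - y`, so the quantifier over
moves in `F_y` collapses to one candidate. This also makes reachability visibly measurable. -/
theorem reverseProjectionSucceeds_iff (S : ExactSolver q) (x y : constraintManifold q g) :
    ReverseProjectionSucceeds S x y ↔ x ∉ unreachable S y := by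
  simp only [unreachable, Set.mem_ofPred_eq, not_not]
  constructor
  · exact fun h => ⟨_, tangentialMove_mem y x, h⟩
  · rintro ⟨v, hv, hvS, hvx⟩
    have h1 : tangentialMove y x = v := by
      rw [tangentialMove, ← hvx, tangentPart_target_sub S hv]
    rw [ReverseProjectionSucceeds, h1]
    exact ⟨hvS, hvx⟩

theorem propose_of_succeeds {S : ExactSolver q} {x : constraintManifold q g}
    {v : EuclideanSpace ℝ (Fin n)} (h : ProposalSucceeds S x v) :
    (propose S x v : EuclideanSpace ℝ (Fin n)) = S.target x v := by
  rw [propose, dif_pos h]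

theorem propose_of_not_succeeds {S : ExactSolver q} {x : constraintManifold q g}
    {v : EuclideanSpace ℝ (Fin n)} (h : ¬ ProposalSucceeds S x v) : propose S x v = x := by
  rw [propose, dif_neg h]

theorem tangentialMove_propose {S : ExactSolver q} {x : constraintManifold q g}
    {v : EuclideanSpace ℝ (Fin n)} (hv : v ∈ tangentSpace q (x : EuclideanSpace ℝ (Fin n)))
    (h : ProposalSucceeds S x v) : tangentialMove x (propose S x v) = v := by
  rw [tangentialMove, propose_of_succeeds h, tangentPart_target_sub S hv]

theorem propose_not_mem_unreachable {S : ExactSolver q} {x : constraintManifold q g}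
    {v : EuclideanSpace ℝ (Fin n)} (hv : v ∈ tangentSpace q (x : EuclideanSpace ℝ (Fin n)))
    (h : ProposalSucceeds S x v) : propose S x v ∉ unreachable S x :=
  not_not.2 ⟨v, hv, h.1, (propose_of_succeeds h).symm⟩

theorem proposalSucceeds_tangentialMove {S : ExactSolver q} {x y : constraintManifold q g}
    (h : y ∉ unreachable S x) : ProposalSucceeds S x (tangentialMove x y) := by
  obtain ⟨h1, h2⟩ := (reverseProjectionSucceeds_iff S y x).2 h
  refine ⟨h1, fun j => ?_⟩
  rw [h2]
  exact y.2.2 j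

theorem propose_tangentialMove {S : ExactSolver q} {x y : constraintManifold q g}
    (h : y ∉ unreachable S x) : propose S x (tangentialMove x y) = y :=
  Subtype.ext ((propose_of_succeeds (proposalSucceeds_tangentialMove h)).trans
    ((reverseProjectionSucceeds_iff S y x).2 h).2)

/-! ### Measurability of moves, reachability and proposals -/

theorem measurable_tangentialMove (hq : ∀ i, ContDiff ℝ (⊤ : ℕ∞) (q i))
    (hrank : ∀ x ∈ constraintManifold q g, LinearIndependent ℝ fun i => gradient (q i) x) :
    Measurable fun w : constraintManifold q g × constraintManifold q g =>
      tangentialMove w.1 w.2 := by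
  have h1 : Continuous fun w : constraintManifold q g × constraintManifold q g =>
      (w.1, (w.2 : EuclideanSpace ℝ (Fin n)) - w.1) := by fun_prop
  exact ((continuous_tangentPart hq hrank).comp h1).measurable

theorem measurableSet_reachable (hq : ∀ i, ContDiff ℝ (⊤ : ℕ∞) (q i))
    (hrank : ∀ x ∈ constraintManifold q g, LinearIndependent ℝ fun i => gradient (q i) x)
    (S : ExactSolver q) :
    MeasurableSet {w : constraintManifold q g × constraintManifold q g |
      w.2 ∉ unreachable S w.1} := by
  simp only [← reverseProjectionSucceeds_iff, ReverseProjectionSucceeds]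
  have h1 : Measurable fun w : constraintManifold q g × constraintManifold q g =>
      ((w.1 : EuclideanSpace ℝ (Fin n)), tangentialMove w.1 w.2) :=
    (measurable_subtype_coe.comp measurable_fst).prodMk (measurable_tangentialMove hq hrank)
  exact (h1 S.measurableSet_success).inter (measurableSet_eq_fun
    ((measurable_target hq S).comp h1) (measurable_subtype_coe.comp measurable_snd))

theorem measurableSet_reachable_right (hq : ∀ i, ContDiff ℝ (⊤ : ℕ∞) (q i))
    (hrank : ∀ x ∈ constraintManifold q g, LinearIndependent ℝ fun i => gradient (q i) x)
    (S : ExactSolver q) (x : constraintManifold q g) :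
    MeasurableSet (unreachable S x)ᶜ :=
  (measurable_prodMk_left (x := x)) (measurableSet_reachable hq hrank S)

theorem measurableSet_proposalSucceeds (hq : ∀ i, ContDiff ℝ (⊤ : ℕ∞) (q i))
    (hg : ∀ j, Continuous (g j)) (S : ExactSolver q) (x : constraintManifold q g) :
    MeasurableSet {v | ProposalSucceeds S x v} := by
  have h1 : Measurable fun v : EuclideanSpace ℝ (Fin n) => ((x : EuclideanSpace ℝ (Fin n)), v) :=
    measurable_prodMk_left
  refine (h1 S.measurableSet_success).inter ?_
  have h2 : ∀ j, MeasurableSet {v : EuclideanSpace ℝ (Fin n) | 0 < g j (S.target x v)} := fun j =>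
    measurableSet_lt measurable_const ((hg j).measurable.comp ((measurable_target hq S).comp h1))
  exact measurableSet_setOfPred.2 (Measurable.forall fun j => measurableSet_setOfPred.1 (h2 j))

theorem measurable_propose (hq : ∀ i, ContDiff ℝ (⊤ : ℕ∞) (q i))
    (hg : ∀ j, Continuous (g j)) (S : ExactSolver q) (x : constraintManifold q g) :
    Measurable (propose S x) := by
  classical
  have h1 : Measurable fun v : EuclideanSpace ℝ (Fin n) => ((x : EuclideanSpace ℝ (Fin n)), v) :=
    measurable_prodMk_left
  have h2 : (fun v => (propose S x v : EuclideanSpace ℝ (Fin n))) =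
      fun v => if ProposalSucceeds S x v then S.target x v else x := by
    ext1 v
    split_ifs with h
    · exact propose_of_succeeds h
    · rw [propose_of_not_succeeds h]
  have h3 : Measurable fun v => (propose S x v : EuclideanSpace ℝ (Fin n)) := by
    rw [h2]
    exact Measurable.ite (measurableSet_proposalSucceeds hq hg S x)
      ((measurable_target hq S).comp h1) measurable_const
  exact h3.subtype_mk (h := fun v => (propose S x v).2)

/-- The coordinates of the tangential moves that lead from `x` into `s`. -/
theorem setOf_propose_mem_eq_preimage (S : ExactSolver q) (x : constraintManifold q g)
    (hx : LinearIndependent ℝ fun i => gradient (q i) (x : EuclideanSpace ℝ (Fin n)))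
    (s : Set (constraintManifold q g)) :
    {c | ProposalSucceeds S x (tangentIsometry _ hx c) ∧
        propose S x (tangentIsometry _ hx c) ∈ s} =
      (fun c => c + isometryCoords (tangentIsometry _ hx) x) ⁻¹'
        (isometryCoords (tangentIsometry _ hx) ''
          ((↑) '' (s ∩ (unreachable S x)ᶜ) : Set (EuclideanSpace ℝ (Fin n)))) := by
  have hmove : ∀ (c : EuclideanSpace ℝ (Fin (n - m))) (y : constraintManifold q g),
      tangentialMove x y = tangentIsometry _ hx c ↔ isometryCoords (tangentIsometry _ hx) y =
        c + isometryCoords (tangentIsometry _ hx) x := by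
    intro c y
    rw [tangentialMove, ← tangentIsometry_isometryCoords hx,
      (tangentIsometry _ hx).injective.eq_iff, map_sub, sub_eq_iff_eq_add]
  ext c
  constructor
  · rintro ⟨h1, h2⟩
    exact ⟨_, ⟨_, ⟨h2, propose_not_mem_unreachable (tangentIsometry_mem hx c) h1⟩, rfl⟩,
      (hmove c _).1 (tangentialMove_propose (tangentIsometry_mem hx c) h1)⟩
  · rintro ⟨_, ⟨y, ⟨hys, hyr⟩, rfl⟩, hyc⟩
    have h1 := (hmove c y).2 hyc
    refine ⟨?_, ?_⟩
    · rw [← h1]; exact proposalSucceeds_tangentialMove hyr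
    · rw [← h1, propose_tangentialMove hyr]; exact hys

/-- The image of Lebesgue measure of `T_x` under the successful proposals. -/
def proposedVolume (S : ExactSolver q) (x : constraintManifold q g) :
    Measure (constraintManifold q g) :=
  ((tangentVolume q (x : EuclideanSpace ℝ (Fin n))).restrict
    {v | ProposalSucceeds S x v}).map (propose S x)

/-- The coordinates of the moves into `s` form the shadow of the reachable part of `s`, translated
by the coordinates of `x`; Lebesgue measure ignores the translation. -/
theorem proposedVolume_apply (hq : ∀ i, ContDiff ℝ (⊤ : ℕ∞) (q i)) (hg : ∀ j, Continuous (g j))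
    (S : ExactSolver q) (x : constraintManifold q g)
    (hx : LinearIndependent ℝ fun i => gradient (q i) (x : EuclideanSpace ℝ (Fin n)))
    {s : Set (constraintManifold q g)} (hs : MeasurableSet s) :
    proposedVolume S x s = volume (isometryCoords (tangentIsometry _ hx) ''
      ((↑) '' (s ∩ (unreachable S x)ᶜ) : Set (EuclideanSpace ℝ (Fin n)))) := by
  have hA : Measurable (tangentIsometry _ hx) := (tangentIsometry _ hx).continuous.measurable
  have h1 := measurable_propose hq hg S x hs
  rw [proposedVolume, Measure.map_apply (measurable_propose hq hg S x) hs,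
    Measure.restrict_apply h1, tangentVolume_eq_map hx,
    Measure.map_apply hA (h1.inter (measurableSet_proposalSucceeds hq hg S x)), Set.inter_comm,
    ← measure_preimage_add_right volume (isometryCoords (tangentIsometry _ hx) x)
      (isometryCoords (tangentIsometry _ hx) '' _), ← setOf_propose_mem_eq_preimage]
  rfl

/-- Turns an estimate `C` valid for all small `δ` into one on a neighbourhood. Flatness passes to
subsets, so the shape of the reachable set is irrelevant. -/
theorem exists_nhds_flatOn_reachable (hq : ∀ i, ContDiff ℝ (⊤ : ℕ∞) (q i))
    (S : ExactSolver q) (x y : constraintManifold q g)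
    (hy : LinearIndependent ℝ fun i => gradient (q i) (y : EuclideanSpace ℝ (Fin n)))
    {C : ℝ≥0 → Set (EuclideanSpace ℝ (Fin n)) → Prop}
    (hC : ∀ᶠ δ in 𝓝[>] (0 : ℝ≥0), ∀ t, FlatOn (tangentIsometry _ hy) δ t → C δ t) :
    ∃ U ∈ 𝓝 y, ∃ δ, ∀ s ⊆ U, C δ ((↑) '' (s ∩ (unreachable S x)ᶜ)) := by
  obtain ⟨δ, hδ, hδ0⟩ := (hC.and self_mem_nhdsWithin).exists
  obtain ⟨U, hU, hflat⟩ := exists_flatOn_constraintManifold (g := g) hq hy hδ0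
  refine ⟨Subtype.val ⁻¹' U, continuous_subtype_val.continuousAt.preimage_mem_nhds hU, δ,
    fun s hs => hδ _ (hflat.mono ?_)⟩
  rintro _ ⟨z, ⟨hz, -⟩, rfl⟩
  exact ⟨z.2, hs hz⟩

theorem continuous_jacobianFactor_right (hq : ∀ i, ContDiff ℝ (⊤ : ℕ∞) (q i))
    (hrank : ∀ x ∈ constraintManifold q g, LinearIndependent ℝ fun i => gradient (q i) x)
    (x : constraintManifold q g) :
    Continuous fun y : constraintManifold q g => jacobianFactor x y := by
  have h1 : Continuous fun y : constraintManifold q g => (x, y) :=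
    continuous_const.prodMk continuous_id
  have h2 := (continuous_jacobianFactor hq hrank).comp h1
  exact h2

/-- The area formula: on the set of points reachable from `x`, the image of Lebesgue measure of
`T_x` under the successful proposals has density `J(·|x)`. -/
theorem proposedVolume_eq_withDensity (hq : ∀ i, ContDiff ℝ (⊤ : ℕ∞) (q i))
    (hg : ∀ j, Continuous (g j))
    (hrank : ∀ x ∈ constraintManifold q g, LinearIndependent ℝ fun i => gradient (q i) x)
    (S : ExactSolver q) (x : constraintManifold q g) :
    proposedVolume S x = ((surfaceMeasure q g).restrict (unreachable S x)ᶜ).withDensity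
      fun y => (jacobianFactor x y : ℝ≥0∞) := by
  have hx := hrank x x.2
  have := isLocallyFiniteMeasure_surfaceMeasure hq hrank
  have hσ : ∀ s, MeasurableSet s → (surfaceMeasure q g).restrict (unreachable S x)ᶜ s =
      μHE[n - m] ((↑) '' (s ∩ (unreachable S x)ᶜ) : Set (EuclideanSpace ℝ (Fin n))) := by
    intro s hs
    rw [Measure.restrict_apply hs, surfaceMeasure_apply]
  have hJ := continuous_jacobianFactor_right hq hrank x
  -- The flat estimates are applied with `A` the tangent isometry at `y` and `B` the coordinates on
  -- `T_x`.
  refine eq_withDensity_of_local_ratio hJ (fun y c hc => ?_) (fun y c hc => ?_)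
  · have hc' := ENNReal.coe_lt_coe.2 hc
    rw [jacobianFactor_eq_det hx (hrank y y.2)] at hc'
    obtain ⟨U, hU, δ, h⟩ := exists_nhds_flatOn_reachable hq S x y (hrank y y.2)
      (C := fun _ t => volume (isometryCoords (tangentIsometry _ hx) '' t) ≤ c * μHE[n - m] t)
      (eventually_volume_image_le_of_det_lt _ (norm_isometryCoords_le _) hc')
    refine ⟨U, hU, fun s hs hsm => ?_⟩
    rw [proposedVolume_apply hq hg S x hx hsm, hσ s hsm]
    exact h s hs
  · have hc' := ENNReal.coe_lt_coe.2 hc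
    rw [jacobianFactor_eq_det hx (hrank y y.2)] at hc'
    obtain ⟨U, hU, δ, h⟩ := exists_nhds_flatOn_reachable hq S x y (hrank y y.2)
      (C := fun _ t => c * μHE[n - m] t ≤ volume (isometryCoords (tangentIsometry _ hx) '' t))
      (eventually_le_volume_image_of_lt_det _ (norm_isometryCoords_le _) hc')
    refine ⟨U, hU, fun s hs hsm => ?_⟩
    rw [proposedVolume_apply hq hg S x hx hsm, hσ s hsm]
    exact h s hs

end Area

/-! ### Proposal and step densities -/

section Densities

variable {n m l : ℕ} {q : Fin m → EuclideanSpace ℝ (Fin n) → ℝ}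
  {g : Fin l → EuclideanSpace ℝ (Fin n) → ℝ}

theorem proposalDensity_of_mem {S : ExactSolver q}
    {p : constraintManifold q g → EuclideanSpace ℝ (Fin n) → ℝ≥0} {x y : constraintManifold q g}
    (h : y ∈ unreachable S x) : proposalDensity S p x y = 0 := by
  simp [proposalDensity, h]

theorem proposalDensity_of_not_mem {S : ExactSolver q}
    {p : constraintManifold q g → EuclideanSpace ℝ (Fin n) → ℝ≥0} {x y : constraintManifold q g}
    (h : y ∉ unreachable S x) :
    proposalDensity S p x y = p x (tangentialMove x y) * jacobianFactor x y := by
  simp [proposalDensity, h]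

theorem measurable_density_at_tangentialMove (hq : ∀ i, ContDiff ℝ (⊤ : ℕ∞) (q i))
    (hrank : ∀ x ∈ constraintManifold q g, LinearIndependent ℝ fun i => gradient (q i) x)
    {p : constraintManifold q g → EuclideanSpace ℝ (Fin n) → ℝ≥0}
    (hp : Measurable (Function.uncurry p)) :
    Measurable fun w : constraintManifold q g × constraintManifold q g =>
      p w.1 (tangentialMove w.1 w.2) := by
  have h1 := hp.comp (measurable_fst.prodMk (measurable_tangentialMove hq hrank))
  exact h1

theorem measurable_proposalDensity (hq : ∀ i, ContDiff ℝ (⊤ : ℕ∞) (q i))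
    (hrank : ∀ x ∈ constraintManifold q g, LinearIndependent ℝ fun i => gradient (q i) x)
    (S : ExactSolver q) {p : constraintManifold q g → EuclideanSpace ℝ (Fin n) → ℝ≥0}
    (hp : Measurable (Function.uncurry p)) :
    Measurable (Function.uncurry (proposalDensity S p)) := by
  have h1 := ((measurable_density_at_tangentialMove hq hrank hp).mul
    (continuous_jacobianFactor hq hrank).measurable).indicator (measurableSet_reachable hq hrank S)
  convert h1 using 1
  ext1 ⟨x, y⟩
  rw [Function.uncurry_apply_pair]
  by_cases h : y ∈ unreachable S x
  · rw [proposalDensity_of_mem h, Set.indicator_of_notMem (by simpa using h)]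
  · rw [proposalDensity_of_not_mem h, Set.indicator_of_mem (by simpa using h)]
    rfl

theorem measurable_metropolisHastings (hq : ∀ i, ContDiff ℝ (⊤ : ℕ∞) (q i))
    (hrank : ∀ x ∈ constraintManifold q g, LinearIndependent ℝ fun i => gradient (q i) x)
    (S : ExactSolver q) {p : constraintManifold q g → EuclideanSpace ℝ (Fin n) → ℝ≥0}
    (hp : Measurable (Function.uncurry p)) {f : constraintManifold q g → ℝ≥0} (hf : Measurable f) :
    Measurable (Function.uncurry (metropolisHastings S f p)) := by
  have h1 := measurable_proposalDensity hq hrank S hp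
  have h2 := h1.comp measurable_swap
  have h3 := ((hf.comp measurable_snd).mul h2).div ((hf.comp measurable_fst).mul h1)
  have h4 := (measurable_const (a := (1 : ℝ≥0))).min h3
  exact h4

theorem metropolisHastings_le_one (S : ExactSolver q)
    (f : constraintManifold q g → ℝ≥0)
    (p : constraintManifold q g → EuclideanSpace ℝ (Fin n) → ℝ≥0) (x y : constraintManifold q g) :
    metropolisHastings S f p x y ≤ 1 :=
  min_le_left _ _

theorem mul_min_one_div (a b : ℝ≥0) : a * min 1 (b / a) = min a b := by
  rcases eq_or_ne a 0 with rfl | ha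
  · simp
  · rw [mul_min, mul_one, mul_div_cancel₀ b ha]

/-- Both sides are the minimum of `f(x) h(y|x)` and `f(y) h(x|y)`. A zero denominator is harmless,
since it is also the factor in front and the minimum is then zero. -/
theorem detailed_balance (S : ExactSolver q) (f : constraintManifold q g → ℝ≥0)
    (p : constraintManifold q g → EuclideanSpace ℝ (Fin n) → ℝ≥0) (x y : constraintManifold q g) :
    f x * metropolisHastings S f p x y * proposalDensity S p x y =
      f y * metropolisHastings S f p y x * proposalDensity S p y x := by
  rw [mul_right_comm, mul_right_comm (f y), metropolisHastings, metropolisHastings,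
    mul_min_one_div, mul_min_one_div, min_comm]

theorem measurable_tangentialMove_right (hq : ∀ i, ContDiff ℝ (⊤ : ℕ∞) (q i))
    (hrank : ∀ x ∈ constraintManifold q g, LinearIndependent ℝ fun i => gradient (q i) x)
    (x : constraintManifold q g) :
    Measurable fun y : constraintManifold q g => tangentialMove x y := by
  have h1 := (measurable_tangentialMove hq hrank).comp (measurable_prodMk_left (x := x))
  exact h1

/-- Change of variables from the tangential move `v` to the proposed point. -/
theorem setLIntegral_tangentLaw (hq : ∀ i, ContDiff ℝ (⊤ : ℕ∞) (q i)) (hg : ∀ j, Continuous (g j))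
    (hrank : ∀ x ∈ constraintManifold q g, LinearIndependent ℝ fun i => gradient (q i) x)
    (S : ExactSolver q) {p : constraintManifold q g → EuclideanSpace ℝ (Fin n) → ℝ≥0}
    (hp : Measurable (Function.uncurry p)) (x : constraintManifold q g)
    {G : EuclideanSpace ℝ (Fin n) → ℝ≥0∞} (hG : Measurable G) :
    ∫⁻ v in {v | ProposalSucceeds S x v}, G v ∂tangentLaw p x =
      ∫⁻ y, G (tangentialMove x y) * proposalDensity S p x y ∂surfaceMeasure q g := by
  have hx := hrank x x.2
  have hsucc := measurableSet_proposalSucceeds hq hg S x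
  have hpx : Measurable fun v => (p x v : ℝ≥0∞) :=
    (hp.comp measurable_prodMk_left).coe_nnreal_ennreal
  have hpG : Measurable fun v => (p x v : ℝ≥0∞) * G v := hpx.mul hG
  -- A move is recovered from its proposal only if it is tangent; `tangentVolume` charges no other
  -- vectors.
  have htan : ∀ᵐ v ∂(tangentVolume q (x : EuclideanSpace ℝ (Fin n))).restrict
      {v | ProposalSucceeds S x v}, tangentialMove x (propose S x v) = v := by
    rw [ae_restrict_iff' hsucc, tangentVolume_eq_map hx]
    refine ((tangentIsometry _ hx).isometry.isClosedEmbedding.measurableEmbedding.ae_map_iff).2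
      (Eventually.of_forall fun c hc => tangentialMove_propose (tangentIsometry_mem hx c) hc)
  have hmove := measurable_tangentialMove_right hq hrank x
  have hpGmove : Measurable fun y =>
      (p x (tangentialMove x y) : ℝ≥0∞) * G (tangentialMove x y) := by
    have h1 := hpG.comp hmove
    exact h1
  have hJ : Measurable fun y => (jacobianFactor x y : ℝ≥0∞) :=
    (continuous_jacobianFactor_right hq hrank x).measurable.coe_nnreal_ennreal
  calc ∫⁻ v in {v | ProposalSucceeds S x v}, G v ∂tangentLaw p x
      = ∫⁻ v in {v | ProposalSucceeds S x v}, p x v * G v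
          ∂tangentVolume q (x : EuclideanSpace ℝ (Fin n)) := by
        rw [tangentLaw, restrict_withDensity hsucc, lintegral_withDensity_eq_lintegral_mul _ hpx hG]
        rfl
    _ = ∫⁻ v in {v | ProposalSucceeds S x v},
          p x (tangentialMove x (propose S x v)) * G (tangentialMove x (propose S x v))
          ∂tangentVolume q (x : EuclideanSpace ℝ (Fin n)) := by
        refine lintegral_congr_ae ?_
        filter_upwards [htan] with v hv
        rw [hv]
    _ = ∫⁻ y, p x (tangentialMove x y) * G (tangentialMove x y) ∂proposedVolume S x :=
        (lintegral_map hpGmove (measurable_propose hq hg S x)).symm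
    _ = ∫⁻ y in (unreachable S x)ᶜ,
          jacobianFactor x y * (p x (tangentialMove x y) * G (tangentialMove x y))
          ∂surfaceMeasure q g := by
        rw [proposedVolume_eq_withDensity hq hg hrank S x,
          lintegral_withDensity_eq_lintegral_mul _ hJ hpGmove]
        rfl
    _ = _ := by
        rw [← lintegral_indicator (measurableSet_reachable_right hq hrank S x)]
        refine lintegral_congr fun y => ?_
        by_cases h : y ∈ unreachable S x
        · rw [proposalDensity_of_mem h, Set.indicator_of_notMem (by simpa using h)]
          simp
        · rw [proposalDensity_of_not_mem h, Set.indicator_of_mem (by simpa using h)]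
          push_cast
          ring

theorem isProbabilityMeasure_tangentLaw
    {p : constraintManifold q g → EuclideanSpace ℝ (Fin n) → ℝ≥0} {x : constraintManifold q g}
    (hp1 : ∫⁻ v, (p x v : ℝ≥0∞) ∂tangentVolume q x = 1) :
    IsProbabilityMeasure (tangentLaw p x) :=
  ⟨by rw [tangentLaw, withDensity_apply _ MeasurableSet.univ, setLIntegral_univ, hp1]⟩

theorem lintegral_proposalDensity_add_failureProb (hq : ∀ i, ContDiff ℝ (⊤ : ℕ∞) (q i))
    (hg : ∀ j, Continuous (g j))
    (hrank : ∀ x ∈ constraintManifold q g, LinearIndependent ℝ fun i => gradient (q i) x)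
    (S : ExactSolver q) {p : constraintManifold q g → EuclideanSpace ℝ (Fin n) → ℝ≥0}
    (hp : Measurable (Function.uncurry p)) {x : constraintManifold q g}
    (hp1 : ∫⁻ v, (p x v : ℝ≥0∞) ∂tangentVolume q x = 1) :
    ∫⁻ y, (proposalDensity S p x y : ℝ≥0∞) ∂surfaceMeasure q g + failureProb S p x = 1 := by
  have := isProbabilityMeasure_tangentLaw hp1
  have h1 := setLIntegral_tangentLaw hq hg hrank S hp x (measurable_const (a := 1))
  simp only [one_mul, setLIntegral_const] at h1
  rw [← h1]
  exact (measure_add_measure_compl (measurableSet_proposalSucceeds hq hg S x)).trans measure_univ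

/-- A random point equal to `φ` on the event `E` and to `x` otherwise has as law the image under
`φ` of the part on `E`, plus an atom at `x`. -/
theorem map_eq_add_smul_dirac {Ω X : Type*} [MeasurableSpace Ω] [MeasurableSpace X] {P : Measure Ω}
    {E : Set Ω} (hE : MeasurableSet E) {φ ψ : Ω → X} {x : X} (hφ : Measurable φ)
    (hin : ∀ ω ∈ E, ψ ω = φ ω) (hout : ∀ ω ∉ E, ψ ω = x) :
    P.map ψ = (P.restrict E).map φ + P {ω | ω ∉ E} • Measure.dirac x := by
  classical
  have hψ : Measurable ψ := by
    have h1 : ψ = E.piecewise φ fun _ => x := by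
      ext1 ω
      by_cases h : ω ∈ E
      · rw [Set.piecewise_eq_of_mem _ _ _ h, hin ω h]
      · rw [Set.piecewise_eq_of_notMem _ _ _ h, hout ω h]
    rw [h1]
    exact hφ.piecewise hE measurable_const
  have h2 : P.map ψ = (P.restrict E + P.restrict Eᶜ).map ψ := by
    rw [Measure.restrict_add_restrict_compl hE]
  rw [h2, Measure.map_add _ _ hψ]
  congr 1
  · refine Measure.map_congr ?_
    filter_upwards [ae_restrict_mem hE] with ω hω using hin ω hω
  · have h3 : (P.restrict Eᶜ).map ψ = (P.restrict Eᶜ).map fun _ => x := by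
      refine Measure.map_congr ?_
      filter_upwards [ae_restrict_mem hE.compl] with ω hω using hout ω hω
    rw [h3, Measure.map_const, Measure.restrict_apply_univ]
    rfl

theorem proposalLaw_eq (hq : ∀ i, ContDiff ℝ (⊤ : ℕ∞) (q i))
    (hg : ∀ j, Continuous (g j))
    (hrank : ∀ x ∈ constraintManifold q g, LinearIndependent ℝ fun i => gradient (q i) x)
    (S : ExactSolver q) {p : constraintManifold q g → EuclideanSpace ℝ (Fin n) → ℝ≥0}
    (hp : Measurable (Function.uncurry p)) (x : constraintManifold q g) :
    proposalLaw S p x =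
      (surfaceMeasure q g).withDensity (fun y => (proposalDensity S p x y : ℝ≥0∞)) +
        failureProb S p x • Measure.dirac x := by
  have hprop := measurable_propose hq hg S x
  have h1 := map_eq_add_smul_dirac (P := tangentLaw p x) (measurableSet_proposalSucceeds hq hg S x)
    hprop (fun _ _ => rfl) (fun _ h => propose_of_not_succeeds h)
  refine h1.trans (congrArg₂ _ (Measure.ext fun s hs => ?_) rfl)
  rw [Measure.map_apply hprop hs, withDensity_apply _ hs, ← lintegral_indicator_one (hprop hs),
    setLIntegral_tangentLaw hq hg hrank S hp x (measurable_one.indicator (hprop hs)),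
    ← lintegral_indicator hs]
  refine lintegral_congr fun y => ?_
  -- At reachable `y`, proposing the tangential move towards `y` returns `y`; elsewhere the density
  -- is zero.
  by_cases h : y ∈ unreachable S x
  · rw [proposalDensity_of_mem h, ENNReal.coe_zero, mul_zero]
    by_cases hys : y ∈ s <;> simp [hys, proposalDensity_of_mem h]
  · by_cases hys : y ∈ s <;> simp [hys, propose_tangentialMove h]

/-! ### The law of a step -/

theorem measurable_acceptProb_propose (hq : ∀ i, ContDiff ℝ (⊤ : ℕ∞) (q i))
    (hg : ∀ j, Continuous (g j))
    (hrank : ∀ x ∈ constraintManifold q g, LinearIndependent ℝ fun i => gradient (q i) x)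
    (S : ExactSolver q) {p : constraintManifold q g → EuclideanSpace ℝ (Fin n) → ℝ≥0}
    (hp : Measurable (Function.uncurry p)) {f : constraintManifold q g → ℝ≥0} (hf : Measurable f)
    (x : constraintManifold q g) :
    Measurable fun v => acceptProb f p x v (propose S x v) := by
  have hprop := measurable_propose hq hg S x
  have h1 := (measurable_density_at_tangentialMove hq hrank hp).comp
    (hprop.prodMk (measurable_const (a := x)))
  have h2 : Measurable fun v => p x v := hp.comp measurable_prodMk_left
  have h3 := ((hf.comp hprop).mul h1).div (h2.const_mul (f x))
  have h4 := (measurable_const (a := (1 : ℝ≥0))).min h3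
  exact h4

theorem measurableSet_reverse_propose (hq : ∀ i, ContDiff ℝ (⊤ : ℕ∞) (q i))
    (hg : ∀ j, Continuous (g j))
    (hrank : ∀ x ∈ constraintManifold q g, LinearIndependent ℝ fun i => gradient (q i) x)
    (S : ExactSolver q) (x : constraintManifold q g) :
    MeasurableSet {v | ReverseProjectionSucceeds S x (propose S x v)} := by
  simp only [reverseProjectionSucceeds_iff]
  exact ((measurable_propose hq hg S x).prodMk (measurable_const (a := x)))
    (measurableSet_reachable hq hrank S)

theorem measurableSet_moveAccepted (hq : ∀ i, ContDiff ℝ (⊤ : ℕ∞) (q i))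
    (hg : ∀ j, Continuous (g j))
    (hrank : ∀ x ∈ constraintManifold q g, LinearIndependent ℝ fun i => gradient (q i) x)
    (S : ExactSolver q) {p : constraintManifold q g → EuclideanSpace ℝ (Fin n) → ℝ≥0}
    (hp : Measurable (Function.uncurry p)) {f : constraintManifold q g → ℝ≥0} (hf : Measurable f)
    (x : constraintManifold q g) :
    MeasurableSet {ω | MoveAccepted S f p x ω} := by
  have h1 : MeasurableSet {ω : EuclideanSpace ℝ (Fin n) × ℝ |
      ω.2 ≤ acceptProb f p x ω.1 (propose S x ω.1)} :=
    measurableSet_le measurable_snd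
      ((measurable_acceptProb_propose hq hg hrank S hp hf x).comp
        measurable_fst).coe_nnreal_real
  exact (measurable_fst (measurableSet_proposalSucceeds hq hg S x)).inter
    (h1.inter (measurable_fst (measurableSet_reverse_propose hq hg hrank S x)))

theorem volume_restrict_Icc_setOf_le {b : ℝ≥0} (hb : b ≤ 1) :
    volume.restrict (Set.Icc (0 : ℝ) 1) {u | u ≤ b} = b := by
  have h1 : {u : ℝ | u ≤ b} ∩ Set.Icc (0 : ℝ) 1 = Set.Icc 0 (b : ℝ) := by
    ext u
    have hb' : (b : ℝ) ≤ 1 := by exact_mod_cast hb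
    simp only [Set.mem_inter_iff, Set.mem_ofPred_eq, Set.mem_Icc]
    constructor
    · exact fun h => ⟨h.2.1, h.1⟩
    · exact fun h => ⟨h.2, h.1, h.2.trans hb'⟩
  have h2 : MeasurableSet {u : ℝ | u ≤ b} := measurableSet_Iic
  rw [Measure.restrict_apply h2, h1, Real.volume_Icc, sub_zero,
    ENNReal.ofReal_coe_nnreal]

/-- The acceptance probability, including the reverse check, agrees with the
Metropolis–Hastings factor wherever the proposal density does not vanish. -/
theorem acceptProb_mul_proposalDensity (S : ExactSolver q)
    (f : constraintManifold q g → ℝ≥0)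
    (p : constraintManifold q g → EuclideanSpace ℝ (Fin n) → ℝ≥0) (x y : constraintManifold q g) :
    {y | ReverseProjectionSucceeds S x y}.indicator (acceptProb f p x (tangentialMove x y)) y *
      proposalDensity S p x y = metropolisHastings S f p x y * proposalDensity S p x y := by
  by_cases hy : y ∈ unreachable S x
  · rw [proposalDensity_of_mem hy, mul_zero, mul_zero]
  -- Where `J` vanishes so does `h`; elsewhere the symmetric factor `J` cancels from the quotient.
  rcases eq_or_ne (jacobianFactor x y) 0 with hJ | hJ
  · rw [proposalDensity_of_not_mem hy, hJ, mul_zero, mul_zero, mul_zero]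
  congr 1
  -- If `y` cannot reach `x`, the check fails and `h(x|y) = 0`, so both factors are zero.
  by_cases hx : x ∈ unreachable S y
  · rw [Set.indicator_of_notMem, metropolisHastings, proposalDensity_of_mem hx]
    · simp
    · simpa [reverseProjectionSucceeds_iff] using hx
  · rw [Set.indicator_of_mem, metropolisHastings, proposalDensity_of_not_mem hx,
      proposalDensity_of_not_mem hy, jacobianFactor_comm y x, acceptProb, ← mul_assoc, ← mul_assoc,
      mul_div_mul_right _ _ hJ]
    simpa [reverseProjectionSucceeds_iff] using hx

/-- For fixed `v`, the accepted `u` in the unit interval form an interval whose length is the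
acceptance probability, or nothing at all. Integrating out `u` leaves an integral over moves, to
which the change of variables applies. -/
theorem inputLaw_accepted_inter (hq : ∀ i, ContDiff ℝ (⊤ : ℕ∞) (q i))
    (hg : ∀ j, Continuous (g j))
    (hrank : ∀ x ∈ constraintManifold q g, LinearIndependent ℝ fun i => gradient (q i) x)
    (S : ExactSolver q) {p : constraintManifold q g → EuclideanSpace ℝ (Fin n) → ℝ≥0}
    (hp : Measurable (Function.uncurry p)) {f : constraintManifold q g → ℝ≥0} (hf : Measurable f)
    (x : constraintManifold q g) {s : Set (constraintManifold q g)} (hs : MeasurableSet s) :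
    inputLaw p x ({ω | propose S x ω.1 ∈ s} ∩ {ω | MoveAccepted S f p x ω}) =
      ∫⁻ y in s, metropolisHastings S f p x y * proposalDensity S p x y ∂surfaceMeasure q g := by
  have hprop := measurable_propose hq hg S x
  have hsucc := measurableSet_proposalSucceeds hq hg S x
  have hmem : MeasurableSet ({v | propose S x v ∈ s} ∩
      {v | ReverseProjectionSucceeds S x (propose S x v)}) :=
    (hprop hs).inter (measurableSet_reverse_propose hq hg hrank S x)
  have hacc : Measurable fun v => (acceptProb f p x v (propose S x v) : ℝ≥0∞) :=
    (measurable_acceptProb_propose hq hg hrank S hp hf x).coe_nnreal_ennreal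
  have hset : MeasurableSet ({ω : EuclideanSpace ℝ (Fin n) × ℝ | propose S x ω.1 ∈ s} ∩
      {ω | MoveAccepted S f p x ω}) :=
    (measurable_fst (hprop hs)).inter (measurableSet_moveAccepted hq hg hrank S hp hf x)
  rw [inputLaw, Measure.prod_apply hset]
  have h1 : ∀ v, volume.restrict (Set.Icc (0 : ℝ) 1) (Prod.mk v ⁻¹'
      ({ω | propose S x ω.1 ∈ s} ∩ {ω | MoveAccepted S f p x ω})) =
      {v | ProposalSucceeds S x v}.indicator (({v | propose S x v ∈ s} ∩
        {v | ReverseProjectionSucceeds S x (propose S x v)}).indicator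
          fun v => (acceptProb f p x v (propose S x v) : ℝ≥0∞)) v := by
    intro v
    by_cases hv : ProposalSucceeds S x v ∧ propose S x v ∈ s ∧
        ReverseProjectionSucceeds S x (propose S x v)
    · have hv1 : v ∈ {v | ProposalSucceeds S x v} := hv.1
      have hv2 : v ∈ {v | propose S x v ∈ s} ∩
        {v | ReverseProjectionSucceeds S x (propose S x v)} := hv.2
      rw [Set.indicator_of_mem hv1, Set.indicator_of_mem hv2,
        ← volume_restrict_Icc_setOf_le (b := acceptProb f p x v (propose S x v)) (min_le_left _ _)]
      congr 1
      ext u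
      simp [MoveAccepted, hv.1, hv.2.1, hv.2.2]
    · have h2 : Prod.mk v ⁻¹' ({ω | propose S x ω.1 ∈ s} ∩ {ω | MoveAccepted S f p x ω}) =
          (∅ : Set ℝ) :=
        Set.eq_empty_of_forall_notMem fun u hu => hv ⟨hu.2.1, hu.1, hu.2.2.2⟩
      have h3 : v ∉ {v | ProposalSucceeds S x v} ∩ ({v | propose S x v ∈ s} ∩
        {v | ReverseProjectionSucceeds S x (propose S x v)}) := hv
      rw [h2, measure_empty, Set.indicator_indicator, Set.indicator_of_notMem h3]
  rw [lintegral_congr h1, lintegral_indicator hsucc,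
    setLIntegral_tangentLaw hq hg hrank S hp x (hacc.indicator hmem), ← lintegral_indicator hs]
  refine lintegral_congr fun y => ?_
  by_cases h : y ∈ unreachable S x
  · by_cases hys : y ∈ s <;> simp [proposalDensity_of_mem h, hys]
  · have h3 := acceptProb_mul_proposalDensity S f p x y
    by_cases hys : y ∈ s
    · rw [Set.indicator_of_mem hys, ← ENNReal.coe_mul, ← h3]
      by_cases hr : ReverseProjectionSucceeds S x y <;>
        simp [propose_tangentialMove h, hys, hr]
    · simp [propose_tangentialMove h, hys]

theorem stepLaw_eq (hq : ∀ i, ContDiff ℝ (⊤ : ℕ∞) (q i))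
    (hg : ∀ j, Continuous (g j))
    (hrank : ∀ x ∈ constraintManifold q g, LinearIndependent ℝ fun i => gradient (q i) x)
    (S : ExactSolver q) {p : constraintManifold q g → EuclideanSpace ℝ (Fin n) → ℝ≥0}
    (hp : Measurable (Function.uncurry p)) {f : constraintManifold q g → ℝ≥0} (hf : Measurable f)
    (x : constraintManifold q g) :
    stepLaw S f p x =
      (surfaceMeasure q g).withDensity
          (fun y => (metropolisHastings S f p x y * proposalDensity S p x y : ℝ≥0∞)) +
        rejectionProb S f p x • Measure.dirac x := by
  have hprop : Measurable fun ω : EuclideanSpace ℝ (Fin n) × ℝ => propose S x ω.1 :=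
    (measurable_propose hq hg S x).comp measurable_fst
  have h1 := map_eq_add_smul_dirac (P := inputLaw p x) (ψ := mcmcStep S f p x) (x := x)
    (measurableSet_moveAccepted hq hg hrank S hp hf x) hprop
    (fun ω h => if_pos h) (fun ω h => if_neg h)
  refine h1.trans (congrArg₂ _ (Measure.ext fun s hs => ?_) rfl)
  rw [Measure.map_apply hprop hs, withDensity_apply _ hs, Measure.restrict_apply (hprop hs)]
  exact inputLaw_accepted_inter hq hg hrank S hp hf x hs

theorem isProbabilityMeasure_inputLaw
    {p : constraintManifold q g → EuclideanSpace ℝ (Fin n) → ℝ≥0} {x : constraintManifold q g}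
    (hp1 : ∫⁻ v, (p x v : ℝ≥0∞) ∂tangentVolume q x = 1) :
    IsProbabilityMeasure (inputLaw p x) := by
  have := isProbabilityMeasure_tangentLaw hp1
  have : IsProbabilityMeasure (volume.restrict (Set.Icc (0 : ℝ) 1)) := ⟨by simp⟩
  unfold inputLaw
  infer_instance

theorem lintegral_acceptance_add_rejectionProb (hq : ∀ i, ContDiff ℝ (⊤ : ℕ∞) (q i))
    (hg : ∀ j, Continuous (g j))
    (hrank : ∀ x ∈ constraintManifold q g, LinearIndependent ℝ fun i => gradient (q i) x)
    (S : ExactSolver q) {p : constraintManifold q g → EuclideanSpace ℝ (Fin n) → ℝ≥0}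
    (hp : Measurable (Function.uncurry p)) {f : constraintManifold q g → ℝ≥0} (hf : Measurable f)
    {x : constraintManifold q g} (hp1 : ∫⁻ v, (p x v : ℝ≥0∞) ∂tangentVolume q x = 1) :
    ∫⁻ y, (metropolisHastings S f p x y * proposalDensity S p x y : ℝ≥0∞) ∂surfaceMeasure q g +
      rejectionProb S f p x = 1 := by
  have := isProbabilityMeasure_inputLaw hp1
  have h1 := inputLaw_accepted_inter hq hg hrank S hp hf x MeasurableSet.univ
  have h2 : {ω : EuclideanSpace ℝ (Fin n) × ℝ | propose S x ω.1 ∈ (Set.univ : Set _)} ∩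
      {ω | MoveAccepted S f p x ω} = {ω | MoveAccepted S f p x ω} := by
    ext ω; simp
  rw [setLIntegral_univ, h2] at h1
  rw [← h1]
  exact (measure_add_measure_compl (measurableSet_moveAccepted hq hg hrank S hp hf x)).trans
    measure_univ

/-- Proposal and step both have total mass one; the finite integral of `a h` cancels between the two
identities. -/
theorem rejectionProb_eq (hq : ∀ i, ContDiff ℝ (⊤ : ℕ∞) (q i))
    (hg : ∀ j, Continuous (g j))
    (hrank : ∀ x ∈ constraintManifold q g, LinearIndependent ℝ fun i => gradient (q i) x)
    (S : ExactSolver q) {p : constraintManifold q g → EuclideanSpace ℝ (Fin n) → ℝ≥0}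
    (hp : Measurable (Function.uncurry p)) {f : constraintManifold q g → ℝ≥0} (hf : Measurable f)
    {x : constraintManifold q g} (hp1 : ∫⁻ v, (p x v : ℝ≥0∞) ∂tangentVolume q x = 1) :
    rejectionProb S f p x = failureProb S p x +
      ∫⁻ y, ((1 - metropolisHastings S f p x y) * proposalDensity S p x y : ℝ≥0∞)
        ∂surfaceMeasure q g := by
  have hah : Measurable fun y =>
      (metropolisHastings S f p x y * proposalDensity S p x y : ℝ≥0∞) := by
    have h1 := ((measurable_metropolisHastings hq hrank S hp hf).coe_nnreal_ennreal.mul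
      (measurable_proposalDensity hq hrank S hp).coe_nnreal_ennreal).comp
      (measurable_prodMk_left (x := x))
    exact h1
  have h2 := lintegral_acceptance_add_rejectionProb hq hg hrank S hp hf hp1
  have h3 : ∫⁻ y, (proposalDensity S p x y : ℝ≥0∞) ∂surfaceMeasure q g =
      ∫⁻ y, (metropolisHastings S f p x y * proposalDensity S p x y : ℝ≥0∞) ∂surfaceMeasure q g +
      ∫⁻ y, ((1 - metropolisHastings S f p x y) * proposalDensity S p x y : ℝ≥0∞)
        ∂surfaceMeasure q g := by
    rw [← lintegral_add_left hah]
    refine lintegral_congr fun y => ?_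
    rw [← add_mul, add_tsub_cancel_of_le, one_mul]
    exact_mod_cast metropolisHastings_le_one S f p x y
  have h4 := lintegral_proposalDensity_add_failureProb hq hg hrank S hp hp1
  have hfin : ∫⁻ y, (metropolisHastings S f p x y * proposalDensity S p x y : ℝ≥0∞)
      ∂surfaceMeasure q g ≠ ⊤ :=
    ((le_self_add.trans_eq h2).trans_lt ENNReal.one_lt_top).ne
  refine (ENNReal.add_right_inj hfin).1 ?_
  rw [h2, add_left_comm, ← h3, add_comm, h4]

/-! ### Reversibility -/

/-- A kernel made of a density `k` and atoms is reversible for `f σ` if `f(x) k(x, y)` is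
symmetric. -/
theorem isReversible_of_density_symm {X : Type*} [MeasurableSpace X] {σ : Measure X} [SFinite σ]
    {κ : Kernel X X} {k : X → X → ℝ≥0∞} (hk : Measurable (Function.uncurry k)) {r : X → ℝ≥0∞}
    (hκ : ∀ x, κ x = σ.withDensity (k x) + r x • Measure.dirac x) {f : X → ℝ≥0∞}
    (hf : Measurable f) (hsymm : ∀ x y, f x * k x y = f y * k y x)
    (c : ℝ≥0∞) : κ.IsReversible (c • σ.withDensity f) := by
  -- The atoms contribute an integral over `A ∩ B`, symmetric whatever `r` is; only the double
  -- integral needs Tonelli and the symmetry of `f k`.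
  have key : ∀ A B : Set X, MeasurableSet A → MeasurableSet B →
      ∫⁻ x in A, κ x B ∂(c • σ.withDensity f) =
        c * (∫⁻ x in A, ∫⁻ y in B, f x * k x y ∂σ ∂σ + ∫⁻ x in A ∩ B, f x * r x ∂σ) := by
    intro A B hA hB
    have hin : Measurable fun x => ∫⁻ y in B, f x * k x y ∂σ :=
      Measurable.lintegral_prod_right' (f := fun w : X × X => f w.1 * k w.1 w.2)
        ((hf.comp measurable_fst).mul hk)
    rw [Measure.restrict_smul, lintegral_smul_measure, smul_eq_mul, restrict_withDensity hA,
      lintegral_withDensity_eq_lintegral_mul _ hf (Kernel.measurable_coe κ hB), Set.inter_comm,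
      ← Measure.restrict_restrict hB, ← lintegral_indicator hB, ← lintegral_add_left hin]
    congr 1
    refine lintegral_congr fun x => ?_
    rw [Pi.mul_apply, hκ, Measure.add_apply, withDensity_apply _ hB, Measure.smul_apply,
      Measure.dirac_apply' _ hB, mul_add, lintegral_const_mul _ (hk.of_uncurry_left (x := x))]
    by_cases hx : x ∈ B <;> simp [hx]
  intro A B hA hB
  rw [key A B hA hB, key B A hB hA, Set.inter_comm B A]
  congr 2
  rw [lintegral_lintegral_swap]
  · exact lintegral_congr fun y => lintegral_congr fun x => hsymm x y
  · exact ((hf.comp measurable_fst).mul hk).aemeasurable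

theorem isProbabilityMeasure_targetMeasure {f : constraintManifold q g → ℝ≥0}
    (hZ0 : ∫⁻ x, (f x : ℝ≥0∞) ∂surfaceMeasure q g ≠ 0)
    (hZ : ∫⁻ x, (f x : ℝ≥0∞) ∂surfaceMeasure q g ≠ ⊤) :
    IsProbabilityMeasure (targetMeasure f) :=
  ⟨by rw [targetMeasure, Measure.smul_apply, withDensity_apply _ MeasurableSet.univ,
    setLIntegral_univ, smul_eq_mul, ENNReal.inv_mul_cancel hZ0 hZ]⟩

end Densities

end

end ConstrainedMCMC

theorem mainTheorem2 {n m l : ℕ}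
    (q : Fin m → EuclideanSpace ℝ (Fin n) → ℝ) (g : Fin l → EuclideanSpace ℝ (Fin n) → ℝ)
    (hq : ∀ i, ContDiff ℝ (⊤ : ℕ∞) (q i)) (hg : ∀ j, Continuous (g j))
    (hrank : ∀ x ∈ constraintManifold q g, LinearIndependent ℝ fun i => gradient (q i) x)
    (S : ExactSolver q)
    (p : constraintManifold q g → EuclideanSpace ℝ (Fin n) → ℝ≥0)
    (hp : Measurable (Function.uncurry p))
    (hp1 : ∀ x : constraintManifold q g, ∫⁻ v, (p x v : ℝ≥0∞) ∂tangentVolume q x = 1)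
    (f : constraintManifold q g → ℝ≥0) (hf : Measurable f)
    (hZ0 : ∫⁻ x, (f x : ℝ≥0∞) ∂surfaceMeasure q g ≠ 0)
    (hZ : ∫⁻ x, (f x : ℝ≥0∞) ∂surfaceMeasure q g ≠ ⊤) :
    -- the law of the proposal is `h(y|x) σ(dy) + ζ(x) δ_x(dy)`
    Measurable (Function.uncurry (proposalDensity S p)) ∧
    (∀ x, proposalLaw S p x =
      (surfaceMeasure q g).withDensity (fun y => (proposalDensity S p x y : ℝ≥0∞)) +
        failureProb S p x • Measure.dirac x) ∧
    (∀ x, ∫⁻ y, (proposalDensity S p x y : ℝ≥0∞) ∂surfaceMeasure q g + failureProb S p x = 1) ∧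
    -- the law of a step is `a(y|x) h(y|x) σ(dy) + ξ(x) δ_x(dy)`
    (∀ x, stepLaw S f p x =
      (surfaceMeasure q g).withDensity
          (fun y => (metropolisHastings S f p x y * proposalDensity S p x y : ℝ≥0∞)) +
        rejectionProb S f p x • Measure.dirac x) ∧
    (∀ x, rejectionProb S f p x = failureProb S p x +
      ∫⁻ y, ((1 - metropolisHastings S f p x y) * proposalDensity S p x y : ℝ≥0∞)
        ∂surfaceMeasure q g) ∧
    -- detailed balance
    (∀ x y, f x * metropolisHastings S f p x y * proposalDensity S p x y =
      f y * metropolisHastings S f p y x * proposalDensity S p y x) ∧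
    -- the algorithm is a Markov kernel, reversible for `ρ`, which it leaves invariant
    IsProbabilityMeasure (targetMeasure f) ∧
    ∃ κ : Kernel (constraintManifold q g) (constraintManifold q g),
      (∀ x, κ x = stepLaw S f p x) ∧ IsMarkovKernel κ ∧
        κ.IsReversible (targetMeasure f) ∧ κ.Invariant (targetMeasure f) := by
  have hσ := isLocallyFiniteMeasure_surfaceMeasure hq hrank
  have hh := measurable_proposalDensity hq hrank S hp
  have ha := measurable_metropolisHastings hq hrank S hp hf
  have hstep := stepLaw_eq hq hg hrank S hp hf
  have hsum := fun x => lintegral_proposalDensity_add_failureProb hq hg hrank S hp (hp1 x)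
  have hrej := fun x => rejectionProb_eq hq hg hrank S hp hf (hp1 x)
  have hk : Measurable (Function.uncurry fun x y =>
      (metropolisHastings S f p x y * proposalDensity S p x y : ℝ≥0∞)) :=
    ha.coe_nnreal_ennreal.mul hh.coe_nnreal_ennreal
  -- Measurability in `x` is read off the mass identity, since the definition of `tangentLaw` passes
  -- through arbitrarily chosen frames.
  have hζ : Measurable (failureProb S p) := by
    have h1 : Measurable fun x => ∫⁻ y, (proposalDensity S p x y : ℝ≥0∞) ∂surfaceMeasure q g :=
      Measurable.lintegral_prod_right' hh.coe_nnreal_ennreal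
    have h2 : failureProb S p =
        fun x => 1 - ∫⁻ y, (proposalDensity S p x y : ℝ≥0∞) ∂surfaceMeasure q g := by
      ext1 x
      refine ENNReal.eq_sub_of_add_eq' ENNReal.one_ne_top ?_
      rw [add_comm, hsum]
    rw [h2]
    exact measurable_const.sub h1
  have hξ : Measurable (rejectionProb S f p) := by
    have h1 : Measurable fun x => ∫⁻ y, ((1 - metropolisHastings S f p x y) *
        proposalDensity S p x y : ℝ≥0∞) ∂surfaceMeasure q g :=
      Measurable.lintegral_prod_right'
        ((measurable_const.sub ha.coe_nnreal_ennreal).mul hh.coe_nnreal_ennreal)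
    rw [funext hrej]
    exact hζ.add h1
  have hprob : ∀ x, IsProbabilityMeasure (stepLaw S f p x) := by
    intro x
    refine ⟨?_⟩
    rw [hstep, Measure.add_apply, withDensity_apply _ MeasurableSet.univ, setLIntegral_univ,
      Measure.smul_apply, measure_univ, smul_eq_mul, mul_one]
    exact lintegral_acceptance_add_rejectionProb hq hg hrank S hp hf (hp1 x)
  let κ : Kernel (constraintManifold q g) (constraintManifold q g) :=
    { toFun := stepLaw S f p
      measurable' := by
        refine Measure.measurable_of_measurable_coe _ fun s hs => ?_
        have h1 : Measurable fun x => ∫⁻ y in s, (metropolisHastings S f p x y *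
            proposalDensity S p x y : ℝ≥0∞) ∂surfaceMeasure q g :=
          Measurable.lintegral_prod_right' hk
        have h2 : ∀ x, stepLaw S f p x s = ∫⁻ y in s, (metropolisHastings S f p x y *
            proposalDensity S p x y : ℝ≥0∞) ∂surfaceMeasure q g +
              rejectionProb S f p x * s.indicator 1 x := fun x => by
          rw [hstep, Measure.add_apply, withDensity_apply _ hs, Measure.smul_apply,
            Measure.dirac_apply' _ hs, smul_eq_mul]
        simp only [h2]
        exact h1.add (hξ.mul (measurable_one.indicator hs)) }
  have hκ : IsMarkovKernel κ := ⟨hprob⟩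
  have hrev : κ.IsReversible (targetMeasure f) := by
    refine isReversible_of_density_symm hk hstep hf.coe_nnreal_ennreal (fun x y => ?_) _
    rw [← mul_assoc, ← mul_assoc]
    exact_mod_cast detailed_balance S f p x y
  exact ⟨hh, proposalLaw_eq hq hg hrank S hp, hsum, hstep, hrej, detailed_balance S f p,
    isProbabilityMeasure_targetMeasure hZ0 hZ, κ, fun _ => rfl, hκ, hrev, hrev.invariant⟩
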